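/- Let $a\in(0,1)$ and $b>1-a$. For $\varepsilon\in[0,1]$ let $P=P_\varepsilon$ be a probability measure under which $(\eta_n)_{n\in\mathbb Z}$ are independent with $P(\eta_n=0)=\varepsilon$ and $P(\eta_n=1)=1-\varepsilon$. Let $X_0=1$, $X_1=a$, $X_{n+1}=aX_n+b\,\eta_{n-1}X_{n-1}$ for $n\ge 1$, and $W_n=\frac1{X_n}\sum_{k=0}^{n-1}X_k$. For $\varepsilon\in(0,1)$ let $(R_n)_{n\in\mathbb Z}$ be the (a.s. unique) positive stationary solution of $R_n=(a+b\,\eta_{n-1}R_{n-1})^{-1}$, i.e. the doubly infinite stationary version of the Markov chain $X_n/X_{n+1}$: $R_n=Z_{k-1}/Z_k$ where $k=\min\{j\ge 1:\eta_{n-j}=0\}$, $Z_0=1$, $Z_1=a$, $Z_{m+1}=aZ_m+bZ_{m-1}$. Put $$\gamma(\varepsilon)=\lim_{n\to\infty}\frac1n E_P(\log X_n),\qquad \varepsilon^*=\sup\{\varepsilon>0:\gamma(\varepsilon)>0\},$$ $$\Lambda_\varepsilon(t)=\lim_{n\to\infty}\frac1n\log E\bigl(R_1^t\cdots R_n^t\bigr)\quad(t\ge0),\qquad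 W^{(\varepsilon)}=\sum_{k=0}^\infty\prod_{j=0}^kR_{-j}\in[0,\infty].$$ Then $\varepsilon^*\in(0,1)$ and $\gamma(\varepsilon^*)=0$. Moreover, for every $\varepsilon\in(0,1)$: the limits defining $\gamma(\varepsilon)$ and $\Lambda_\varepsilon(t)$, $t\ge 0$, exist and are finite; $\frac1n\log X_n\to\gamma(\varepsilon)$ $P$-a.s.; $\Lambda_\varepsilon(t)=\lim_{n\to\infty}\frac1n\log E_P(X_n^{-t})$ for $t\ge0$; the one-sided derivative $\Lambda_\varepsilon'(0)$ at $0$ exists; $W_n$ converges in distribution to $W^{(\varepsilon)}$ (as $[0,\infty]$-valued random variables); and the following are equivalent: (i) $\gamma(\varepsilon)>0$; (i$'$) $\varepsilon<\varepsilon^*$; (ii) $\Lambda_\varepsilon'(0)<0$; (iii) there exists a unique $s_\varepsilon>0$ such that $\Lambda_\varepsilon(s_\varepsilon)=0$; (iv) $W^{(\varepsilon)}$ is almost surely finite and non-degenerate (not almost surely equal to a constant). -/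

import Mathlib

open MeasureTheory ProbabilityTheory Filter Set
open scoped Topology ENNReal unitInterval

namespace RandomFib

/-- The sample space: doubly infinite sequences of noise symbols; `ω n = false` encodes `η_n = 0`
and `ω n = true` encodes `η_n = 1`. -/
abbrev Noise : Type := ℤ → Bool

/-- The law `P` of the noise with parameter `ε`: the coordinates are independent,
`η_n = 0` with probability `ε` and `η_n = 1` with probability `1 - ε`. -/
noncomputable def noiseLaw (ε : I) : Measure Noise :=
  Measure.infinitePi fun _ : ℤ => bernoulliMeasure false true ε

instance noiseLaw_isProbabilityMeasure (ε : I) : IsProbabilityMeasure (noiseLaw ε) := by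
  unfold noiseLaw
  infer_instance

/-- The Bernoulli random variable `η_n`. -/
def η (n : ℤ) (ω : Noise) : ℝ := if ω n then 1 else 0

/-- The random sequence `X_0 = 1`, `X_1 = a`, `X_{n+1} = a X_n + b η_{n-1} X_{n-1}`. -/
noncomputable def X (a b : ℝ) : ℕ → Noise → ℝ
  | 0, _ => 1
  | 1, _ => a
  | n + 2, ω => a * X a b (n + 1) ω + b * η (n : ℤ) ω * X a b n ω

/-- The relative partial sums `W_n = (X_0 + ⋯ + X_{n-1}) / X_n`. -/
noncomputable def partialW (a b : ℝ) (n : ℕ) (ω : Noise) : ℝ :=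
  (∑ k ∈ Finset.range n, X a b k ω) / X a b n ω

/-- The noiseless sequence `Z_0 = 1`, `Z_1 = a`, `Z_{n+1} = a Z_n + b Z_{n-1}`. -/
noncomputable def Z (a b : ℝ) : ℕ → ℝ
  | 0 => 1
  | 1 => a
  | n + 2 => a * Z a b (n + 1) + b * Z a b n

/-- The least `k ≥ 1` such that `η_{n-k} = 0`. Such a `k` exists almost surely when `ε > 0`; on the
exceptional null set the value is `0`. -/
noncomputable def age (n : ℤ) (ω : Noise) : ℕ :=
  sInf {k : ℕ | 1 ≤ k ∧ ω (n - k) = false}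

/-- The doubly infinite stationary version `(R_n)_{n ∈ ℤ}` of the Markov chain of ratios
`X_n / X_{n+1}`, that is, the stationary solution of `R_n = (a + b η_{n-1} R_{n-1})⁻¹`
(see `R_recursion`): it is in the state `S_k = Z_{k-1} / Z_k`, where `n - k` is the time of the
last zero of the noise before time `n`. Its law under `noiseLaw ε` is the stationary law `Q`. -/
noncomputable def R (a b : ℝ) (n : ℤ) (ω : Noise) : ℝ :=
  Z a b (age n ω - 1) / Z a b (age n ω)

/-- The random variable `W = ∑_{k ≥ 0} ∏_{j=0}^{k} R_{-j}`, with values in `[0, ∞]`. -/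
noncomputable def W (a b : ℝ) (ω : Noise) : ℝ≥0∞ :=
  ∑' k : ℕ, ENNReal.ofReal (∏ j ∈ Finset.range (k + 1), R a b (-(j : ℤ)) ω)

/-- The Lyapunov exponent `γ(ε) = lim n⁻¹ E_P (log X_n)`. -/
noncomputable def γ (a b : ℝ) (ε : I) : ℝ :=
  limUnder atTop fun n : ℕ => (n : ℝ)⁻¹ * ∫ ω, Real.log (X a b n ω) ∂noiseLaw ε

/-- The critical noise level `ε* = sup {ε > 0 : γ(ε) > 0}`. -/
noncomputable def εstar (a b : ℝ) : I := sSup {ε : I | 0 < ε ∧ 0 < γ a b ε}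

/-- `Λ_ε(t) = lim n⁻¹ log E_Q (R_1^t ⋯ R_n^t)`. -/
noncomputable def Λ (a b : ℝ) (ε : I) (t : ℝ) : ℝ :=
  limUnder atTop fun n : ℕ =>
    (n : ℝ)⁻¹ * Real.log (∫ ω, ∏ k ∈ Finset.Icc 1 n, R a b (k : ℤ) ω ^ t ∂noiseLaw ε)

theorem Z_pos {a b : ℝ} (ha : 0 < a) (hb : 0 < b) : ∀ n, 0 < Z a b n
  | 0 => one_pos
  | 1 => ha
  | n + 2 => by
    have h1 := Z_pos ha hb (n + 1)
    have h2 := Z_pos ha hb n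
    rw [Z]
    positivity

theorem R_recursion {a b : ℝ} (ha : 0 < a) (hb : 0 < b) (n : ℤ) (ω : Noise)
    (h : ∃ k : ℕ, 1 ≤ k ∧ ω (n - 1 - k) = false) :
    R a b n ω = (a + b * η (n - 1) ω * R a b (n - 1) ω)⁻¹ := by
  have hmem : 1 ≤ age (n - 1) ω ∧ ω (n - 1 - age (n - 1) ω) = false :=
    Nat.sInf_mem (s := {k : ℕ | 1 ≤ k ∧ ω (n - 1 - k) = false}) h
  cases hω : ω (n - 1) with
  | false =>
    have hage : age n ω = 1 := by
      apply le_antisymm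
      · exact Nat.sInf_le (by simpa using hω)
      · exact (Nat.sInf_mem (s := {k : ℕ | 1 ≤ k ∧ ω (n - k) = false}) ⟨1, by simpa using hω⟩).1
    simp [R, hage, η, hω, Z]
  | true =>
    have hage : age n ω = age (n - 1) ω + 1 := by
      have hm : 1 ≤ age (n - 1) ω + 1 ∧ ω (n - ((age (n - 1) ω + 1 : ℕ) : ℤ)) = false := by
        refine ⟨by omega, ?_⟩
        rw [← hmem.2]
        congr 1
        push_cast
        ring
      apply le_antisymm
      · exact Nat.sInf_le hm
      · have hm' : 1 ≤ age n ω ∧ ω (n - age n ω) = false :=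
          Nat.sInf_mem (s := {k : ℕ | 1 ≤ k ∧ ω (n - k) = false}) ⟨_, hm⟩
        obtain ⟨j, hj⟩ : ∃ j, age n ω = j + 1 := ⟨age n ω - 1, by omega⟩
        rw [hj] at hm' ⊢
        have hj1 : 1 ≤ j := by
          rcases Nat.eq_zero_or_pos j with rfl | hpos
          · simp [hω] at hm'
          · exact hpos
        have : age (n - 1) ω ≤ j := by
          refine Nat.sInf_le ⟨hj1, ?_⟩
          rw [← hm'.2]
          congr 1
          push_cast
          ring
        omega
    obtain ⟨j, hj⟩ : ∃ j, age (n - 1) ω = j + 1 := ⟨age (n - 1) ω - 1, by omega⟩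
    have h1 := Z_pos ha hb (j + 1)
    have h0 := Z_pos ha hb j
    simp only [R, hage, hj, η, hω, Nat.add_sub_cancel, if_true, Z]
    field_simp

end RandomFib

/-! Everything rests on quasi-multiplicativity. With `C = quasiConst a b`, two positive solutions of
the recursion with the same initial value and initial ratios in `[a, C * a]` differ by a factor at
most `C`. Hence `X (m + n)` agrees, up to the factor `C`, with the product of `X m` and the shifted
`X n`, which are independent; and `X n` agrees up to `C` with the inverse product of the stationary
ratios `R`.

Fekete's lemma then gives `γ` and `Λ` with explicit finite-`n` errors. So `γ` is a uniform limit of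
polynomials in `ε`, hence continuous; a monotone coupling makes it antitone; it is positive at `ε =
0` and negative at `ε = 1`. This gives the statements on `εstar`. The strong law for independent
blocks gives the almost sure limit.

The function `Λ` is convex with `Λ 0 = 0` and right derivative `-γ` at `0`, and it tends to infinity
because long runs of zeros make `X` as small as `a ^ n`. Such a function has a unique positive zero
exactly when `γ > 0`.

If `γ > 0`, some `s ∈ (0, 1)` has `Λ s < 0`, so the `s`-th moments of the terms of `W` decay
geometrically and `W` is finite. Conversely, if `W` is finite, `W ∘ shift 1 = R 1 * (1 + W)` makes
`log R 1` a coboundary of `log W` minus a positive function, so its mean is negative and `γ > 0`.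
Convergence in law becomes almost sure convergence after shifting the noise so that time `n` stays
at the origin. -/

namespace RandomFib

/-- The shift by `m` of the noise. -/
def shift (m : ℤ) (ω : Noise) : Noise := fun k => ω (k + m)

/-- The constant up to which `X` is multiplicative along the shift. -/
noncomputable def quasiConst (a b : ℝ) : ℝ := 1 + b / a ^ 2

/-- The noise has a zero before every time. -/
def ZerosInPast (ω : Noise) : Prop := ∀ n : ℤ, ∃ k : ℕ, 1 ≤ k ∧ ω (n - k) = false

/-! ### Pathwise estimates for the recursion and for the stationary ratios. -/

section Deterministic

variable {a b : ℝ}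

theorem shift_shift (m n : ℤ) (ω : Noise) : shift m (shift n ω) = shift (m + n) ω := by
  funext k
  simp [shift, add_assoc]

@[simp]
theorem shift_zero (ω : Noise) : shift 0 ω = ω := by
  funext k
  simp [shift]

theorem η_shift (n m : ℤ) (ω : Noise) : η n (shift m ω) = η (n + m) ω := rfl

theorem η_nonneg (n : ℤ) (ω : Noise) : 0 ≤ η n ω := by
  unfold η
  split_ifs <;> simp

theorem η_le_one (n : ℤ) (ω : Noise) : η n ω ≤ 1 := by
  unfold η
  split_ifs <;> simp

theorem X_zero (ω : Noise) : X a b 0 ω = 1 := by simp [X]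

theorem X_one (ω : Noise) : X a b 1 ω = a := by simp [X]

theorem X_add_two (n : ℕ) (ω : Noise) :
    X a b (n + 2) ω = a * X a b (n + 1) ω + b * η (n : ℤ) ω * X a b n ω := by rw [X]

theorem X_pos (ha : 0 < a) (hb : 0 < b) (n : ℕ) (ω : Noise) : 0 < X a b n ω := by
  induction n using Nat.twoStepInduction with
  | zero => simp [X_zero]
  | one => simpa [X_one]
  | more n h0 h1 =>
    rw [X_add_two]
    have := η_nonneg n ω
    positivity

theorem mul_X_le_X_succ (ha : 0 < a) (hb : 0 < b) (n : ℕ) (ω : Noise) :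
    a * X a b n ω ≤ X a b (n + 1) ω := by
  cases n with
  | zero => simp [X_zero, X_one]
  | succ n =>
    rw [X_add_two]
    have h0 := X_pos ha hb n ω
    have := η_nonneg n ω
    have : 0 ≤ b * η n ω * X a b n ω := by positivity
    linarith

theorem one_le_quasiConst (hb : 0 < b) : 1 ≤ quasiConst a b := by
  unfold quasiConst
  have : 0 ≤ b / a ^ 2 := by positivity
  linarith

theorem quasiConst_pos (hb : 0 < b) : 0 < quasiConst a b :=
  one_pos.trans_le (one_le_quasiConst hb)

theorem quasiConst_mul (ha : 0 < a) : quasiConst a b * a = a + b / a := by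
  unfold quasiConst
  field_simp

/-- The ratio of consecutive terms is `a` plus at most `b` times the previous inverse ratio, which
is at most `1 / a`; `quasiConst` is chosen so that `quasiConst a b * a = a + b / a`. -/
theorem X_succ_le (ha : 0 < a) (hb : 0 < b) (n : ℕ) (ω : Noise) :
    X a b (n + 1) ω ≤ quasiConst a b * a * X a b n ω := by
  rw [quasiConst_mul ha]
  cases n with
  | zero =>
    have : 0 ≤ b / a := by positivity
    simp [X_zero, X_one, this]
  | succ n =>
    rw [X_add_two]
    have h0 := X_pos ha hb n ω
    have h1 := mul_X_le_X_succ ha hb n ω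
    have h2 : b * η n ω * X a b n ω ≤ b * 1 * X a b n ω := by
      gcongr
      exact η_le_one n ω
    have h3 : b * X a b n ω ≤ b / a * X a b (n + 1) ω := by
      rw [div_mul_eq_mul_div, le_div_iff₀ ha]
      nlinarith
    linarith

/-- Comparison of a positive solution of the recursion with the solution `X` of the shifted
recursion. -/
theorem compare_X (ha : 0 < a) (hb : 0 < b) (y : ℕ → ℝ) (k : ℤ) (ω : Noise) (h0 : 0 ≤ y 0)
    (hrec : ∀ n : ℕ, y (n + 2) = a * y (n + 1) + b * η (n + k) ω * y n)
    (h1 : a * y 0 ≤ y 1) (h2 : y 1 ≤ quasiConst a b * a * y 0) (n : ℕ) :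
    y 0 * X a b n (shift k ω) ≤ y n ∧ y n ≤ quasiConst a b * (y 0 * X a b n (shift k ω)) := by
  -- Both sequences solve the same linear recursion with nonnegative coefficients, so inequalities
  -- at times `0` and `1` propagate.
  induction n using Nat.twoStepInduction with
  | zero =>
    simp only [X_zero, mul_one, le_refl, true_and]
    exact le_mul_of_one_le_left h0 (one_le_quasiConst hb)
  | one =>
    simp only [X_one]
    constructor <;> linarith
  | more n ih0 ih1 =>
    rw [X_add_two, hrec, η_shift]
    have hη := η_nonneg (n + k) ω
    have hbη : 0 ≤ b * η (n + k) ω := by positivity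
    have e1 := mul_le_mul_of_nonneg_left ih0.1 hbη
    have e2 := mul_le_mul_of_nonneg_left ih0.2 hbη
    have e3 := mul_le_mul_of_nonneg_left ih1.1 ha.le
    have e4 := mul_le_mul_of_nonneg_left ih1.2 ha.le
    constructor <;> linarith

theorem X_mul_le (ha : 0 < a) (hb : 0 < b) (m n : ℕ) (ω : Noise) :
    X a b m ω * X a b n (shift m ω) ≤ X a b (m + n) ω ∧
      X a b (m + n) ω ≤ quasiConst a b * (X a b m ω * X a b n (shift m ω)) := by
  refine compare_X ha hb (fun n => X a b (m + n) ω) m ω (X_pos ha hb _ _).le (fun n => ?_)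
    (mul_X_le_X_succ ha hb m ω) (X_succ_le ha hb m ω) n
  have := X_add_two (a := a) (b := b) (m + n) ω
  push_cast at this
  rw [add_comm (m : ℤ)] at this
  exact this

theorem log_X_add (ha : 0 < a) (hb : 0 < b) (m n : ℕ) (ω : Noise) :
    Real.log (X a b m ω) + Real.log (X a b n (shift m ω)) ≤ Real.log (X a b (m + n) ω) ∧
      Real.log (X a b (m + n) ω) ≤ Real.log (quasiConst a b) +
        (Real.log (X a b m ω) + Real.log (X a b n (shift m ω))) := by
  have h := X_mul_le ha hb m n ω
  have h1 := X_pos ha hb m ω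
  have h2 := X_pos ha hb n (shift m ω)
  have h3 := X_pos ha hb (m + n) ω
  have hC := quasiConst_pos (a := a) hb
  rw [← Real.log_mul h1.ne' h2.ne', ← Real.log_mul hC.ne' (by positivity)]
  exact ⟨Real.log_le_log (by positivity) h.1, Real.log_le_log h3 h.2⟩

/-- A bound for the increments of `log X`. -/
noncomputable def logBound (a b : ℝ) : ℝ := |Real.log a| + |Real.log (quasiConst a b * a)|

theorem logBound_nonneg : 0 ≤ logBound a b := by unfold logBound; positivity

theorem abs_log_X_succ_sub (ha : 0 < a) (hb : 0 < b) (n : ℕ) (ω : Noise) :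
    |Real.log (X a b (n + 1) ω) - Real.log (X a b n ω)| ≤ logBound a b := by
  have h1 := X_pos ha hb n ω
  have h3 := X_pos ha hb (n + 1) ω
  have hC := quasiConst_pos (a := a) hb
  have e1 := Real.log_le_log (by positivity) (mul_X_le_X_succ ha hb n ω)
  have e2 := Real.log_le_log h3 (X_succ_le ha hb n ω)
  rw [Real.log_mul ha.ne' h1.ne'] at e1
  rw [Real.log_mul (by positivity) h1.ne'] at e2
  unfold logBound
  rw [abs_le]
  have f1 := neg_abs_le (Real.log a)
  have f2 := le_abs_self (Real.log (quasiConst a b * a))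
  have f3 := abs_nonneg (Real.log a)
  have f4 := abs_nonneg (Real.log (quasiConst a b * a))
  constructor <;> linarith

theorem abs_log_X_add_sub (ha : 0 < a) (hb : 0 < b) (n r : ℕ) (ω : Noise) :
    |Real.log (X a b (n + r) ω) - Real.log (X a b n ω)| ≤ r * logBound a b := by
  induction r with
  | zero => simp
  | succ r ih =>
    have h := abs_log_X_succ_sub ha hb (n + r) ω
    have : Real.log (X a b (n + (r + 1)) ω) - Real.log (X a b n ω) =
      (Real.log (X a b (n + r + 1) ω) - Real.log (X a b (n + r) ω)) +
      (Real.log (X a b (n + r) ω) - Real.log (X a b n ω)) := by rw [← add_assoc]; ring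
    rw [this]
    refine (abs_add_le _ _).trans ?_
    push_cast
    linarith

theorem abs_log_X_le (ha : 0 < a) (hb : 0 < b) (n : ℕ) (ω : Noise) :
    |Real.log (X a b n ω)| ≤ n * logBound a b := by
  have := abs_log_X_add_sub ha hb 0 n ω
  simpa [X_zero] using this

theorem R_pos (ha : 0 < a) (hb : 0 < b) (n : ℤ) (ω : Noise) : 0 < R a b n ω :=
  div_pos (Z_pos ha hb _) (Z_pos ha hb _)

theorem inv_R_add_one (ha : 0 < a) (hb : 0 < b) {ω : Noise} (hω : ZerosInPast ω) (n : ℤ) :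
    (R a b (n + 1) ω)⁻¹ = a + b * η n ω * R a b n ω := by
  rw [R_recursion ha hb (n + 1) ω (hω _), inv_inv]
  simp

theorem le_inv_R (ha : 0 < a) (hb : 0 < b) {ω : Noise} (hω : ZerosInPast ω) (n : ℤ) :
    a ≤ (R a b n ω)⁻¹ := by
  have h := inv_R_add_one ha hb hω (n - 1)
  rw [sub_add_cancel] at h
  rw [h]
  have h1 := R_pos ha hb (n - 1) ω
  have h2 := η_nonneg (n - 1) ω
  have : 0 ≤ b * η (n - 1) ω * R a b (n - 1) ω := by positivity
  linarith

theorem inv_R_le (ha : 0 < a) (hb : 0 < b) {ω : Noise} (hω : ZerosInPast ω) (n : ℤ) :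
    (R a b n ω)⁻¹ ≤ quasiConst a b * a := by
  have h := inv_R_add_one ha hb hω (n - 1)
  rw [sub_add_cancel] at h
  rw [h, quasiConst_mul ha]
  have h1 := R_pos ha hb (n - 1) ω
  have h2 := η_le_one (n - 1) ω
  have h3 : R a b (n - 1) ω ≤ a⁻¹ := by
    rw [← inv_inv (R a b (n - 1) ω)]
    exact inv_anti₀ ha (le_inv_R ha hb hω _)
  have : b * η (n - 1) ω * R a b (n - 1) ω ≤ b * 1 * a⁻¹ := by gcongr
  rw [mul_one, ← div_eq_mul_inv] at this
  linarith

theorem abs_log_R_le (ha : 0 < a) (hb : 0 < b) {ω : Noise} (hω : ZerosInPast ω) (n : ℤ) :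
    |Real.log (R a b n ω)| ≤ logBound a b := by
  have hR := R_pos ha hb n ω
  have e1 := Real.log_le_log ha (le_inv_R ha hb hω n)
  have e2 := Real.log_le_log (by positivity) (inv_R_le ha hb hω n)
  rw [Real.log_inv] at e1 e2
  unfold logBound
  rw [abs_le]
  have f1 := neg_abs_le (Real.log a)
  have f2 := le_abs_self (Real.log (quasiConst a b * a))
  have f3 := abs_nonneg (Real.log a)
  have f4 := abs_nonneg (Real.log (quasiConst a b * a))
  constructor <;> linarith

theorem prod_R_pos (ha : 0 < a) (hb : 0 < b) (m : ℤ) (n : ℕ) (ω : Noise) :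
    0 < ∏ i ∈ Finset.range n, R a b (m + i) ω :=
  Finset.prod_pos fun _ _ => R_pos ha hb _ _

/-- Products of stationary ratios are comparable to inverses of `X`. -/
theorem inv_prod_R_bounds (ha : 0 < a) (hb : 0 < b) {ω : Noise} (hω : ZerosInPast ω) (m : ℤ)
    (n : ℕ) : X a b n (shift m ω) ≤ (∏ i ∈ Finset.range n, R a b (m + i) ω)⁻¹ ∧
      (∏ i ∈ Finset.range n, R a b (m + i) ω)⁻¹ ≤ quasiConst a b * X a b n (shift m ω) := by
  -- By `inv_R_add_one` the inverse products solve the recursion driven by the noise shifted by `m`.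
  have h := compare_X ha hb (fun n => (∏ i ∈ Finset.range n, R a b (m + i) ω)⁻¹) m ω (by simp)
    (fun n => ?_) ?_ ?_ n
  · simpa using h
  · have h1 := inv_R_add_one ha hb hω (m + n)
    have hR := R_pos ha hb (m + n) ω
    rw [Finset.prod_range_succ, mul_inv]
    push_cast
    rw [← add_assoc, h1, Finset.prod_range_succ, mul_inv, add_comm (n : ℤ) m]
    field_simp
  · simpa using le_inv_R ha hb hω m
  · simpa using inv_R_le ha hb hω m

/-- After the first zero of the noise the ratios of `X` coincide with the stationary ratios. -/
theorem X_eq_X_succ_mul_R (ha : 0 < a) (hb : 0 < b) {ω : Noise} (hω : ZerosInPast ω) (m : ℤ)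
    (i : ℕ) (h : ∃ l : ℕ, l < i ∧ ω (m + l) = false) :
    X a b i (shift m ω) = X a b (i + 1) (shift m ω) * R a b (m + i) ω := by
  induction i with
  | zero => simp at h
  | succ i ih =>
    have hR := inv_R_add_one ha hb hω (m + i)
    have hRp := R_pos ha hb (m + i + 1) ω
    rw [inv_eq_iff_eq_inv] at hR
    push_cast
    rw [← add_assoc, hR, eq_mul_inv_iff_mul_eq₀ (inv_pos.1 (hR ▸ hRp)).ne',
      X_add_two, η_shift, add_comm (i : ℤ) m]
    -- A zero of the noise resets both ratios to `1 / a`, whatever the past; at a one, equality is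
    -- inherited from the previous ratio.
    cases hi : ω (m + i) with
    | false => simp [η, hi, mul_comm]
    | true =>
      obtain ⟨l, hl, hl'⟩ := h
      have : l ≠ i := by rintro rfl; simp [hi] at hl'
      have := ih ⟨l, by omega, hl'⟩
      rw [this]
      ring

theorem X_eq_X_add_mul_prod (ha : 0 < a) (hb : 0 < b) {ω : Noise} (hω : ZerosInPast ω) (m : ℤ)
    (i n : ℕ) (h : ∃ l : ℕ, l < i ∧ ω (m + l) = false) :
    X a b i (shift m ω) =
      X a b (i + n) (shift m ω) * ∏ q ∈ Finset.range n, R a b (m + i + q) ω := by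
  induction n with
  | zero => simp
  | succ n ih =>
    obtain ⟨l, hl, hl'⟩ := h
    rw [ih, X_eq_X_succ_mul_R ha hb hω m (i + n) ⟨l, by omega, hl'⟩, Finset.prod_range_succ,
      ← add_assoc]
    push_cast
    rw [← add_assoc]
    ring

end Deterministic

/-! ### Shift invariance, independence and monotone coupling of the noise. -/

section Noise

theorem measurable_shift (m : ℤ) : Measurable (shift m) := by
  unfold shift
  fun_prop

theorem measurePreserving_shift (ε : I) (m : ℤ) :
    MeasurePreserving (shift m) (noiseLaw ε) (noiseLaw ε) := by
  refine ⟨measurable_shift m, ?_⟩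
  have h := Measure.infinitePi_map_piCongrLeft
    (fun _ : ℤ => bernoulliMeasure false true ε) (Equiv.subRight m)
  suffices he : shift m = MeasurableEquiv.piCongrLeft (fun _ : ℤ => Bool) (Equiv.subRight m) by
    rw [he]
    exact h
  funext ω k
  have := Equiv.piCongrLeft_apply_apply (fun _ : ℤ => Bool) (Equiv.subRight m) ω (k + m)
  simp only [Equiv.subRight_apply, add_sub_cancel_right] at this
  exact this.symm

/-- Factoring through the finite space `s → Bool` reduces measurability, independence and dependence
on `ε` to finite statements. -/
theorem exists_eq_comp_restrict {β : Type*} [Nonempty β] {f : Noise → β} {s : Finset ℤ}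
    (hf : DependsOn f (s : Set ℤ)) : ∃ g : (s → Bool) → β, f = g ∘ s.restrict :=
  dependsOn_iff_exists_comp.1 hf

theorem measurable_of_dependsOn {f : Noise → ℝ} {s : Finset ℤ}
    (hf : DependsOn f (s : Set ℤ)) : Measurable f := by
  obtain ⟨g, rfl⟩ := exists_eq_comp_restrict hf
  exact (measurable_of_countable g).comp (Finset.measurable_restrict s)

theorem indepFun_of_dependsOn (ε : I) {f g : Noise → ℝ} {s t : Finset ℤ}
    (hf : DependsOn f (s : Set ℤ)) (hg : DependsOn g (t : Set ℤ)) (hst : Disjoint s t) :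
    IndepFun f g (noiseLaw ε) := by
  obtain ⟨f', rfl⟩ := exists_eq_comp_restrict hf
  obtain ⟨g', rfl⟩ := exists_eq_comp_restrict hg
  have h : iIndepFun (fun (i : ℤ) (ω : Noise) => ω i) (noiseLaw ε) :=
    iIndepFun_infinitePi (P := fun _ : ℤ => bernoulliMeasure false true ε)
      (X := fun _ x => x) (fun _ => measurable_id)
  exact (h.indepFun_finset s t hst (fun i => measurable_pi_apply i)).comp
    (measurable_of_countable f') (measurable_of_countable g')

theorem continuous_integral_of_dependsOn {f : Noise → ℝ} {s : Finset ℤ}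
    (hf : DependsOn f (s : Set ℤ)) : Continuous fun ε : I => ∫ ω, f ω ∂noiseLaw ε := by
  obtain ⟨g, rfl⟩ := exists_eq_comp_restrict hf
  -- The integral is a finite sum over configurations, hence a polynomial in `ε`.
  have h : ∀ ε : I, ∫ ω, (g ∘ s.restrict) ω ∂noiseLaw ε =
      ∑ x : s → Bool, (∏ i, if x i then 1 - (ε : ℝ) else ε) * g x := by
    intro ε
    have := integral_restrict_infinitePi (μ := fun _ : ℤ => bernoulliMeasure false true ε)
      (s := s) (f := g) (measurable_of_countable g).aestronglyMeasurable
    refine (this.trans (integral_fintype (.of_finite))).trans (Finset.sum_congr rfl fun x _ => ?_)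
    rw [smul_eq_mul, Measure.real, Measure.pi_singleton, ENNReal.toReal_prod]
    congr 1
    refine Finset.prod_congr rfl fun i _ => ?_
    rw [← Measure.real]
    cases x i <;> simp
  simp_rw [h]
  refine continuous_finsetSum _ fun x _ => Continuous.mul ?_ continuous_const
  refine continuous_finsetProd _ fun i _ => ?_
  split_ifs <;> fun_prop

theorem dependsOn_shift {β : Type*} {f : Noise → β} {k l : ℤ}
    (hf : DependsOn f (Finset.Ico k l : Set ℤ)) (m : ℤ) :
    DependsOn (fun ω => f (shift m ω)) (Finset.Ico (k + m) (l + m) : Set ℤ) := by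
  intro x y h
  refine hf fun i hi => h (i + m) ?_
  simp only [Finset.coe_Ico, Set.mem_Ico] at hi ⊢
  omega

theorem noiseLaw_forall_mem_eq (ε : I) (s : Finset ℤ) (c : Bool) :
    noiseLaw ε {ω | ∀ k ∈ s, ω k = c} = (bernoulliMeasure false true ε {c}) ^ s.card := by
  have h := Measure.infinitePi_pi (fun _ : ℤ => bernoulliMeasure false true ε) (s := s)
    (t := fun _ => {c}) (fun _ _ => measurableSet_singleton _)
  rw [Finset.prod_const] at h
  rw [← h]
  rfl

theorem bernoulli_false (ε : I) :
    bernoulliMeasure false true ε {false} = ENNReal.ofReal ε := by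
  rw [bernoulliMeasure_apply _ (measurableSet_singleton _)]
  simp [ENNReal.ofReal, unitInterval.toNNReal, Real.toNNReal_of_nonneg ε.2.1]
  rfl

theorem bernoulli_true (ε : I) :
    bernoulliMeasure false true ε {true} = ENNReal.ofReal (1 - ε) := by
  rw [bernoulliMeasure_apply _ (measurableSet_singleton _)]
  have : 0 ≤ 1 - (ε : ℝ) := sub_nonneg.2 ε.2.2
  simp [ENNReal.ofReal, unitInterval.toNNReal, Real.toNNReal_of_nonneg this]
  rfl

/-- The `N` symbols before time `n` are all ones with probability `(1 - ε) ^ N`, which tends to `0`.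
-/
theorem ae_zerosInPast {ε : I} (hε : 0 < ε) : ∀ᵐ ω ∂noiseLaw ε, ZerosInPast ω := by
  unfold ZerosInPast
  rw [ae_all_iff]
  intro n
  rw [ae_iff]
  have hε' : (0 : ℝ) < ε := hε
  have hle : ∀ N : ℕ, noiseLaw ε {ω | ¬∃ k : ℕ, 1 ≤ k ∧ ω (n - k) = false} ≤
      ENNReal.ofReal (1 - ε) ^ N := by
    intro N
    have h := noiseLaw_forall_mem_eq ε (Finset.Ico (n - N) n) true
    simp only [Int.card_Ico, sub_sub_cancel, Int.toNat_natCast, bernoulli_true] at h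
    rw [← h]
    refine measure_mono fun ω hω k hk => ?_
    simp only [mem_ofPred_eq, not_exists, not_and, Bool.not_eq_false] at hω
    rw [Finset.mem_Ico] at hk
    have := hω (n - k).toNat (by omega)
    rwa [show n - ((n - k).toNat : ℤ) = k by omega] at this
  have hlim := ENNReal.tendsto_pow_atTop_nhds_zero_of_lt_one
    (r := ENNReal.ofReal (1 - ε)) (by rw [ENNReal.ofReal_lt_one]; linarith)
  exact le_antisymm (ge_of_tendsto' hlim hle) zero_le

theorem map_or_bernoulli (p q : I) :
    ((bernoulliMeasure false true p).prod (bernoulliMeasure false true q)).map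
      (fun x : Bool × Bool => x.1 || x.2) = bernoulliMeasure false true (p * q) := by
  have hm : Measurable (fun x : Bool × Bool => x.1 || x.2) := measurable_of_countable _
  have hP := Measure.isProbabilityMeasure_map (μ := (bernoulliMeasure false true p).prod
    (bernoulliMeasure false true q)) hm.aemeasurable
  have hf : ((bernoulliMeasure false true p).prod (bernoulliMeasure false true q)).map
      (fun x : Bool × Bool => x.1 || x.2) {false} = bernoulliMeasure false true (p * q) {false} := by
    rw [Measure.map_apply hm (measurableSet_singleton _)]
    have : (fun x : Bool × Bool => x.1 || x.2) ⁻¹' {false} = {false} ×ˢ {false} := by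
      ext ⟨x, y⟩
      simp
    rw [this, Measure.prod_prod, bernoulli_false, bernoulli_false, bernoulli_false,
      ← ENNReal.ofReal_mul p.2.1]
    rfl
  refine Measure.ext_of_singleton fun c => ?_
  cases c with
  | false => exact hf
  | true =>
    have hc : ({true} : Set Bool) = {false}ᶜ := by ext x; simp
    rw [hc, prob_compl_eq_one_sub (measurableSet_singleton _),
      prob_compl_eq_one_sub (measurableSet_singleton _), hf]

/-- Monotone coupling of the noise at two levels. -/
theorem integral_le_integral_mul {f : Noise → ℝ} (hf : Measurable f) {K : ℝ}
    (hK : ∀ ω, |f ω| ≤ K) (hmono : ∀ ω ω' : Noise, (∀ k, ω k = true → ω' k = true) → f ω ≤ f ω')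
    (p q : I) : ∫ ω, f ω ∂noiseLaw p ≤ ∫ ω, f ω ∂noiseLaw (p * q) := by
  -- Independent pairs of symbols: the first entry has level `p`, the disjunction of both has level
  -- `p * q` and dominates the first entry.
  set μ : Measure (ℤ → Bool × Bool) := Measure.infinitePi fun _ : ℤ =>
    (bernoulliMeasure false true p).prod (bernoulliMeasure false true q) with hμ
  have hor : Measurable (fun x : Bool × Bool => x.1 || x.2) := measurable_of_countable _
  have h1 : μ.map (fun x i => (x i).1) = noiseLaw p := by
    rw [hμ, Measure.infinitePi_map_pi (f := fun _ (x : Bool × Bool) => x.1) _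
      (fun _ => measurable_fst)]
    simp only [noiseLaw]
    congr 1
    funext i
    exact Measure.fst_prod
  have h2 : μ.map (fun x i => (x i).1 || (x i).2) = noiseLaw (p * q) := by
    rw [hμ, Measure.infinitePi_map_pi (f := fun _ (x : Bool × Bool) => x.1 || x.2) _
      (fun _ => hor)]
    simp only [noiseLaw]
    congr 1
    funext i
    exact map_or_bernoulli p q
  have m1 : Measurable (fun (x : ℤ → Bool × Bool) i => (x i).1) := by fun_prop
  have m2 : Measurable (fun (x : ℤ → Bool × Bool) i => (x i).1 || (x i).2) :=
    measurable_pi_lambda _ fun i => hor.comp (measurable_pi_apply i)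
  rw [← h1, ← h2, integral_map m1.aemeasurable hf.aestronglyMeasurable,
    integral_map m2.aemeasurable hf.aestronglyMeasurable]
  refine integral_mono ?_ ?_ fun x => hmono _ _ fun k hk => by simp [hk]
  · exact .of_bound (hf.comp m1).aestronglyMeasurable K (.of_forall fun x => hK _)
  · exact .of_bound (hf.comp m2).aestronglyMeasurable K (.of_forall fun x => hK _)

end Noise

/-! ### Monotonicity, finite dependence and measurability. -/

section Measurability

variable {a b : ℝ}

theorem X_mono (ha : 0 < a) (hb : 0 < b) (n : ℕ) {ω ω' : Noise}
    (h : ∀ k, ω k = true → ω' k = true) : X a b n ω ≤ X a b n ω' := by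
  induction n using Nat.twoStepInduction with
  | zero => simp [X_zero]
  | one => simp [X_one]
  | more n h0 h1 =>
    rw [X_add_two, X_add_two]
    have hη : η n ω ≤ η n ω' := by
      unfold η
      split_ifs with h1 h2
      · rfl
      · exact absurd (h _ h1) h2
      · exact zero_le_one
      · rfl
    have := X_pos ha hb n ω
    have := η_nonneg n ω'
    gcongr

/-- The window `[0, n)` is larger than necessary, but it makes consecutive blocks use disjoint
windows. -/
theorem dependsOn_X (n : ℕ) : DependsOn (X a b n) (Finset.Ico 0 (n : ℤ) : Set ℤ) := by
  intro x y h
  induction n using Nat.twoStepInduction with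
  | zero => simp [X_zero]
  | one => simp [X_one]
  | more n h0 h1 =>
    simp only [Finset.coe_Ico, Set.mem_Ico] at *
    rw [X_add_two, X_add_two, h0 fun i hi => h i (by push_cast; omega),
      h1 fun i hi => h i (by push_cast at *; omega)]
    simp only [η]
    rw [h n (by push_cast; omega)]

theorem dependsOn_log_X (n : ℕ) :
    DependsOn (fun ω => Real.log (X a b n ω)) (Finset.Ico 0 (n : ℤ) : Set ℤ) :=
  fun _ _ h => congrArg Real.log (dependsOn_X n h)

theorem measurable_X (n : ℕ) : Measurable (X a b n) := measurable_of_dependsOn (dependsOn_X n)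

theorem measurable_age (n : ℤ) : Measurable (age n) := by
  refine measurable_to_countable' fun k => ?_
  have hc : ∀ (j : ℕ) (c : Bool), MeasurableSet {ω : Noise | ω (n - j) = c} := fun j c =>
    measurableSet_eq_fun (measurable_pi_apply (n - (j : ℤ))) measurable_const
  -- The value `0` is the default of `sInf` on the empty set: no zero before time `n`.
  cases k with
  | zero =>
    have : age n ⁻¹' {0} = ⋂ j : ℕ, {ω : Noise | ω (n - (j + 1 : ℕ)) = true} := by
      ext ω
      simp only [mem_preimage, mem_singleton_iff, age, Nat.sInf_eq_zero, mem_iInter, mem_ofPred_eq,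
        Set.eq_empty_iff_forall_notMem, not_and, Bool.not_eq_false]
      constructor
      · rintro (h | h) j
        · omega
        · exact h (j + 1) (by omega)
      · refine fun h => Or.inr fun x hx => ?_
        obtain ⟨j, rfl⟩ : ∃ j, x = j + 1 := ⟨x - 1, by omega⟩
        exact h j
    rw [this]
    exact .iInter fun j => hc _ _
  | succ k =>
    have : age n ⁻¹' {k + 1} = {ω : Noise | ω (n - (k + 1 : ℕ)) = false} ∩
        ⋂ j : ℕ, ⋂ (_ : j < k), {ω : Noise | ω (n - (j + 1 : ℕ)) = true} := by
      ext ω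
      simp only [mem_preimage, mem_singleton_iff, age, mem_inter_iff, mem_iInter, mem_ofPred_eq]
      constructor
      · intro h
        have hne : {k : ℕ | 1 ≤ k ∧ ω (n - k) = false}.Nonempty :=
          Nat.nonempty_of_sInf_eq_succ h
        have hm := Nat.sInf_mem hne
        rw [h] at hm
        refine ⟨hm.2, fun j hj => ?_⟩
        have := Nat.notMem_of_lt_sInf (s := {k : ℕ | 1 ≤ k ∧ ω (n - k) = false}) (m := j + 1)
          (by omega)
        simpa using this
      · rintro ⟨h1, h2⟩
        have hmem : k + 1 ∈ {k : ℕ | 1 ≤ k ∧ ω (n - k) = false} := ⟨by omega, h1⟩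
        refine le_antisymm (Nat.sInf_le hmem) ?_
        by_contra! hlt
        have hm := Nat.sInf_mem (s := {k : ℕ | 1 ≤ k ∧ ω (n - k) = false}) ⟨_, hmem⟩
        set j := sInf {k : ℕ | 1 ≤ k ∧ ω (n - k) = false}
        obtain ⟨i, hi⟩ : ∃ i, j = i + 1 := ⟨j - 1, by have := hm.1; omega⟩
        have := h2 i (by omega)
        rw [← hi, hm.2] at this
        exact absurd this (by simp)
    rw [this]
    exact (hc _ _).inter (.iInter fun j => .iInter fun _ => hc _ _)

theorem measurable_R (n : ℤ) : Measurable (R a b n) :=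
  (measurable_of_countable fun k : ℕ => Z a b (k - 1) / Z a b k).comp (measurable_age n)

theorem measurable_W : Measurable (W a b) := by
  unfold W
  refine Measurable.tsum fun k => ENNReal.measurable_ofReal.comp ?_
  exact Finset.measurable_prod _ fun j _ => measurable_R _

theorem measurable_partialW (n : ℕ) : Measurable (partialW a b n) := by
  unfold partialW
  exact (Finset.measurable_sum _ fun k _ => measurable_X k).div (measurable_X n)

theorem age_shift (n m : ℤ) (ω : Noise) : age n (shift m ω) = age (n + m) ω := by
  unfold age shift
  congr 1
  ext k
  rw [mem_ofPred_eq, mem_ofPred_eq, sub_add_eq_add_sub]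

theorem R_shift (n m : ℤ) (ω : Noise) : R a b n (shift m ω) = R a b (n + m) ω := by
  unfold R
  rw [age_shift]

end Measurability

/-- Fekete's lemma with an error bound, for sequences additive up to a constant. -/
theorem exists_tendsto_of_almost_additive {u : ℕ → ℝ} {C K : ℝ} (hC : 0 ≤ C) (hK : 0 ≤ K)
    (hu : ∀ n, |u n| ≤ n * K) (h : ∀ m n, u (m + n) ≤ u m + u n ∧ u m + u n ≤ u (m + n) + C) :
    ∃ L, Tendsto (fun n : ℕ => (n : ℝ)⁻¹ * u n) atTop (𝓝 L) ∧
      ∀ n : ℕ, n * L ≤ u n ∧ u n ≤ n * L + C := by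
  have hs : Subadditive u := fun m n => (h m n).1
  -- Fekete's lemma applies to `u` and to `C - u`; the limits are opposite since `C / n → 0`, and
  -- each limit bounds its sequence from one side at every `n`.
  have hs' : Subadditive fun n => C - u n := fun m n => by
    have := (h m n).2
    change C - u (m + n) ≤ (C - u m) + (C - u n)
    linarith
  have hbelow : ∀ v : ℕ → ℝ, (∀ n : ℕ, -(n * K) ≤ v n) → BddBelow (range fun n => v n / n) := by
    intro v hv
    refine ⟨-K, ?_⟩
    rintro _ ⟨n, rfl⟩
    rcases Nat.eq_zero_or_pos n with rfl | hn
    · simpa using hK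
    · have hn' : (0 : ℝ) < n := by exact_mod_cast hn
      simp only
      rw [le_div_iff₀ hn']
      linarith [hv n]
  have hb := hbelow u fun n => (abs_le.1 (hu n)).1
  have hb' := hbelow (fun n => C - u n) fun n => by linarith [(abs_le.1 (hu n)).2]
  have ht := hs.tendsto_lim hb
  have ht' := hs'.tendsto_lim hb'
  have hC0 : Tendsto (fun n : ℕ => C / (n : ℝ)) atTop (𝓝 0) := tendsto_const_div_atTop_nhds_zero_nat C
  have hlim : hs'.lim = -hs.lim := by
    refine tendsto_nhds_unique ht' ?_
    simpa [sub_div] using hC0.sub ht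
  refine ⟨hs.lim, ?_, fun n => ?_⟩
  · simpa [div_eq_inv_mul] using ht
  · rcases Nat.eq_zero_or_pos n with rfl | hn
    · have := hu 0
      simp only [CharP.cast_eq_zero, zero_mul, abs_nonpos_iff] at this
      simp [this, hC]
    · have hn' : (0 : ℝ) < n := by exact_mod_cast hn
      have h1 := hs.lim_le_div hb hn.ne'
      have h2 := hs'.lim_le_div hb' hn.ne'
      rw [hlim, le_div_iff₀ hn'] at h2
      rw [le_div_iff₀ hn'] at h1
      constructor <;> linarith

/-! ### The Lyapunov exponent as a function of the noise level. -/

section Lyapunov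

variable {a b : ℝ}

theorem log_quasiConst_nonneg (hb : 0 < b) : 0 ≤ Real.log (quasiConst a b) :=
  Real.log_nonneg (one_le_quasiConst hb)

theorem integrable_log_X (ha : 0 < a) (hb : 0 < b) (ε : I) (n : ℕ) :
    Integrable (fun ω => Real.log (X a b n ω)) (noiseLaw ε) :=
  .of_bound (measurable_X n).log.aestronglyMeasurable (n * logBound a b)
    (.of_forall fun ω => abs_log_X_le ha hb n ω)

theorem integral_comp_shift (ε : I) (m : ℤ) {f : Noise → ℝ} (hf : Measurable f) :
    ∫ ω, f (shift m ω) ∂noiseLaw ε = ∫ ω, f ω ∂noiseLaw ε := by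
  conv_rhs => rw [← (measurePreserving_shift ε m).map_eq]
  rw [integral_map (measurable_shift m).aemeasurable hf.aestronglyMeasurable]

theorem integrable_log_X_shift (ha : 0 < a) (hb : 0 < b) (ε : I) (n : ℕ) (m : ℤ) :
    Integrable (fun ω => Real.log (X a b n (shift m ω))) (noiseLaw ε) :=
  (measurePreserving_shift ε m).integrable_comp_of_integrable (integrable_log_X ha hb ε n)

theorem γ_spec (ha : 0 < a) (hb : 0 < b) (ε : I) :
    Tendsto (fun n : ℕ => (n : ℝ)⁻¹ * ∫ ω, Real.log (X a b n ω) ∂noiseLaw ε) atTop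
      (𝓝 (γ a b ε)) ∧
    ∀ n : ℕ, ∫ ω, Real.log (X a b n ω) ∂noiseLaw ε ≤ n * γ a b ε ∧
      n * γ a b ε ≤ ∫ ω, Real.log (X a b n ω) ∂noiseLaw ε + Real.log (quasiConst a b) := by
  have hadd : ∀ m n : ℕ, ∫ ω, (Real.log (X a b m ω) + Real.log (X a b n (shift m ω))) ∂noiseLaw ε =
      ∫ ω, Real.log (X a b m ω) ∂noiseLaw ε + ∫ ω, Real.log (X a b n ω) ∂noiseLaw ε := by
    intro m n
    rw [integral_add (integrable_log_X ha hb ε m)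
      (integrable_log_X_shift ha hb ε n m),
      integral_comp_shift ε m (measurable_X n).log]
  have hint : ∀ m n : ℕ, Integrable (fun ω => Real.log (X a b m ω) +
      Real.log (X a b n (shift m ω))) (noiseLaw ε) := fun m n =>
    (integrable_log_X ha hb ε m).add (integrable_log_X_shift ha hb ε n m)
  obtain ⟨L, hL, hL'⟩ := exists_tendsto_of_almost_additive
    (u := fun n => -∫ ω, Real.log (X a b n ω) ∂noiseLaw ε) (log_quasiConst_nonneg (a := a) hb)
    (logBound_nonneg (a := a) (b := b)) (fun n => by
      rw [abs_neg]
      have := norm_integral_le_of_norm_le_const (μ := noiseLaw ε) (f := fun ω => Real.log (X a b n ω))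
        (C := n * logBound a b) (.of_forall fun ω => abs_log_X_le ha hb n ω)
      simpa using this) (fun m n => by
      have h1 := integral_mono (hint m n) (integrable_log_X ha hb ε (m + n))
        (fun ω => (log_X_add ha hb m n ω).1)
      have h2 := integral_mono (integrable_log_X ha hb ε (m + n))
        ((integrable_const (Real.log (quasiConst a b))).add (hint m n))
        (fun ω => (log_X_add ha hb m n ω).2)
      simp only [Pi.add_apply] at h2
      rw [integral_add (integrable_const _) (hint m n), hadd] at h2
      rw [hadd] at h1
      simp only [integral_const, probReal_univ, one_smul] at h2
      constructor <;> linarith)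
  have hγ : γ a b ε = -L := by
    refine Tendsto.limUnder_eq ?_
    simpa using hL.neg
  refine ⟨?_, fun n => ?_⟩
  · rw [hγ]
    simpa using hL.neg
  · rw [hγ]
    have := hL' n
    constructor <;> linarith [this.1, this.2]

/-- By `γ_spec` the finite-`n` approximations are within `log (quasiConst a b) / n` of the limit,
uniformly in `ε`, and each is continuous. -/
theorem continuous_γ (ha : 0 < a) (hb : 0 < b) : Continuous (γ a b) := by
  have hu : TendstoUniformly (fun (n : ℕ) (ε : I) =>
      (n : ℝ)⁻¹ * ∫ ω, Real.log (X a b n ω) ∂noiseLaw ε) (γ a b) atTop := by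
    rw [Metric.tendstoUniformly_iff]
    intro δ hδ
    have h0 := tendsto_const_div_atTop_nhds_zero_nat (Real.log (quasiConst a b))
    filter_upwards [h0.eventually (gt_mem_nhds hδ), eventually_gt_atTop 0] with n hn hn0 ε
    have hn' : (0 : ℝ) < n := by exact_mod_cast hn0
    have h := (γ_spec ha hb ε).2 n
    refine lt_of_le_of_lt ?_ hn
    have he : γ a b ε - (n : ℝ)⁻¹ * ∫ ω, Real.log (X a b n ω) ∂noiseLaw ε =
        (n * γ a b ε - ∫ ω, Real.log (X a b n ω) ∂noiseLaw ε) / n := by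
      field_simp
    rw [Real.dist_eq, he, abs_div, abs_of_pos hn']
    gcongr
    rw [abs_le]
    constructor <;> linarith [h.1, h.2, log_quasiConst_nonneg (a := a) hb]
  refine hu.continuous (Frequently.of_forall fun n => ?_)
  exact continuous_const.mul (continuous_integral_of_dependsOn (dependsOn_log_X n))

theorem antitone_γ (ha : 0 < a) (hb : 0 < b) : Antitone (γ a b) := by
  intro p q hpq
  rcases eq_or_lt_of_le (show 0 ≤ q from q.2.1) with h0 | h0
  · have : p = q := le_antisymm hpq (h0 ▸ p.2.1)
    rw [this]
  · have hq : (0 : ℝ) < q := h0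
    have hpq' : (p : ℝ) ≤ q := hpq
    -- The coupling compares level `q` with level `q * r`, so `r` is chosen to make this `p`.
    set r : I := ⟨p / q, div_nonneg p.2.1 q.2.1, div_le_one_of_le₀ hpq' q.2.1⟩
    have hr : q * r = p := by
      ext
      change (q : ℝ) * (p / q) = p
      field_simp
    refine le_of_tendsto_of_tendsto' (γ_spec ha hb q).1 (γ_spec ha hb p).1 fun n => ?_
    refine mul_le_mul_of_nonneg_left ?_ (by positivity)
    rw [← hr]
    exact integral_le_integral_mul (measurable_X n).log (abs_log_X_le ha hb n)
      (fun ω ω' h => Real.log_le_log (X_pos ha hb n ω) (X_mono ha hb n h)) q r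

/-- Without zeros in the noise `X` grows geometrically, because `a + b > 1` leaves room for a rate
`l > 1` with `l ^ 2 ≤ a * l + b`. A single `n` with `X n > 1` then suffices, since the mean of `log
(X n)` is at most `n * γ`. -/
theorem γ_zero_pos (ha : a ∈ Ioo (0 : ℝ) 1) (hb : 1 - a < b) : 0 < γ a b 0 := by
  have hb0 : 0 < b := by linarith [ha.2]
  obtain ⟨l, hl1, hl⟩ : ∃ l : ℝ, 1 < l ∧ l ^ 2 ≤ a * l + b := by
    -- With `l = 1 + d`: `(1 + d) ^ 2 ≤ 1 + 3 * d ≤ a + b ≤ a * (1 + d) + b`.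
    set d := min 1 ((a + b - 1) / 3)
    have hd : 0 < d := lt_min one_pos (by linarith)
    have hd1 : d ≤ 1 := min_le_left _ _
    have hd2 : d ≤ (a + b - 1) / 3 := min_le_right _ _
    exact ⟨1 + d, by linarith, by nlinarith [ha.1, mul_pos ha.1 hd]⟩
  have hX : ∀ n, a / l * l ^ n ≤ X a b n (fun _ => true) := by
    intro n
    induction n using Nat.twoStepInduction with
    | zero =>
      rw [X_zero, pow_zero, mul_one, div_le_one (by linarith)]
      linarith [ha.2]
    | one =>
      rw [X_one, pow_one, div_mul_cancel₀ _ (by linarith)]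
    | more n h0 h1 =>
      rw [X_add_two]
      have hc : 0 ≤ a / l * l ^ n := by have := ha.1; positivity
      have e0 := mul_le_mul_of_nonneg_left h0 hb0.le
      have e1 := mul_le_mul_of_nonneg_left h1 ha.1.le
      have e2 := mul_le_mul_of_nonneg_left hl hc
      simp only [η, if_true, mul_one]
      calc a / l * l ^ (n + 2) = a / l * l ^ n * l ^ 2 := by ring
        _ ≤ _ := e2
        _ = a * (a / l * l ^ (n + 1)) + b * (a / l * l ^ n) := by ring
        _ ≤ _ := by linarith
  have hc : 0 < a / l := div_pos ha.1 (by linarith)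
  have ht : Tendsto (fun n : ℕ => a / l * l ^ n) atTop atTop :=
    (tendsto_pow_atTop_atTop_of_one_lt hl1).const_mul_atTop hc
  obtain ⟨n, hn⟩ := (ht.eventually (eventually_gt_atTop 1)).exists
  have h := ((γ_spec ha.1 hb0 0).2 n).1
  have hlaw : noiseLaw 0 = Measure.dirac (fun _ => true) := by
    simp [noiseLaw, Measure.infinitePi_dirac (fun _ : ℤ => true)]
  rw [hlaw, integral_dirac' _ _ (measurable_X n).log.stronglyMeasurable] at h
  have hpos := Real.log_pos (hn.trans_le (hX n))
  by_contra! hneg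
  have : (n : ℝ) * γ a b 0 ≤ 0 := mul_nonpos_of_nonneg_of_nonpos n.cast_nonneg hneg
  linarith

theorem X_of_forall_false {n : ℕ} {ω : Noise} (h : ∀ k : ℤ, 0 ≤ k → k < n → ω k = false) :
    X a b n ω = a ^ n := by
  induction n using Nat.twoStepInduction with
  | zero => simp [X_zero]
  | one => simp [X_one]
  | more n h0 h1 =>
    rw [X_add_two, h1 fun k hk hk' => h k hk (by push_cast at *; omega)]
    simp only [η, h n (by omega) (by push_cast; omega)]
    simp
    ring

theorem γ_one_neg (ha : a ∈ Ioo (0 : ℝ) 1) (hb : 0 < b) : γ a b 1 < 0 := by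
  have hlaw : noiseLaw 1 = Measure.dirac (fun _ => false) := by
    simp [noiseLaw, Measure.infinitePi_dirac (fun _ : ℤ => false)]
  have h := (γ_spec ha.1 hb 1).1
  have h' : Tendsto (fun n : ℕ => (n : ℝ)⁻¹ * ∫ ω, Real.log (X a b n ω) ∂noiseLaw 1) atTop
      (𝓝 (Real.log a)) := by
    refine tendsto_const_nhds.congr' ?_
    filter_upwards [eventually_gt_atTop 0] with n hn
    have hn' : (0 : ℝ) < n := by exact_mod_cast hn
    rw [hlaw, integral_dirac' _ _ (measurable_X n).log.stronglyMeasurable,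
      X_of_forall_false fun _ _ _ => rfl, Real.log_pow]
    field_simp
  rw [tendsto_nhds_unique h h']
  exact Real.log_neg ha.1 ha.2

end Lyapunov

/-- Continuity makes positivity of `g` persist slightly to the right, so positive points lie
strictly below the supremum; antitonicity makes every point below it positive. At the supremum
itself either sign would contradict one of these two facts. -/
theorem sSup_pos_spec {g : I → ℝ} (hg : Continuous g) (hmono : Antitone g) (h0 : 0 < g 0)
    (h1 : g 1 < 0) :
    (sSup {ε : I | 0 < ε ∧ 0 < g ε} ∈ Ioo (0 : I) 1 ∧ g (sSup {ε : I | 0 < ε ∧ 0 < g ε}) = 0) ∧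
      ∀ ε, 0 < g ε ↔ ε < sSup {ε : I | 0 < ε ∧ 0 < g ε} := by
  set e := sSup {ε : I | 0 < ε ∧ 0 < g ε}
  have hA : ∀ ε, 0 < g ε → ε < e := by
    intro ε hε
    have hlt : ε < 1 := lt_of_le_of_ne ε.2.2 (by rintro rfl; linarith)
    have : (𝓝[>] ε).NeBot := nhdsGT_neBot_of_exists_gt ⟨1, hlt⟩
    have h := (hg.tendsto ε).eventually (lt_mem_nhds hε)
    obtain ⟨ε', hε', hgt⟩ := ((h.filter_mono nhdsWithin_le_nhds).and
      (self_mem_nhdsWithin : Ioi ε ∈ 𝓝[>] ε)).exists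
    exact lt_of_lt_of_le hgt (le_sSup ⟨lt_of_le_of_lt ε.2.1 hgt, hε'⟩)
  have hB : ∀ ε, ε < e → 0 < g ε := by
    intro ε hε
    obtain ⟨ε', ⟨-, h⟩, hlt⟩ := lt_sSup_iff.1 hε
    exact h.trans_le (hmono hlt.le)
  have hpos : 0 < e := hA 0 h0
  have hC : g e = 0 := by
    refine le_antisymm (not_lt.1 fun h => lt_irrefl _ (hA e h)) (not_lt.1 fun h => ?_)
    have : (𝓝[<] e).NeBot := nhdsLT_neBot_of_exists_lt ⟨0, hpos⟩
    have h := (hg.tendsto e).eventually (gt_mem_nhds h)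
    obtain ⟨ε', hε', hlt⟩ := ((h.filter_mono nhdsWithin_le_nhds).and
      (self_mem_nhdsWithin : Iio e ∈ 𝓝[<] e)).exists
    exact lt_asymm hε' (hB ε' hlt)
  refine ⟨⟨⟨hpos, lt_of_le_of_ne e.2.2 fun h => ?_⟩, hC⟩, fun ε => ⟨hA ε, hB ε⟩⟩
  rw [h] at hC
  linarith

theorem εstar_spec {a b : ℝ} (ha : a ∈ Ioo (0 : ℝ) 1) (hb : 1 - a < b) :
    (εstar a b ∈ Ioo (0 : I) 1 ∧ γ a b (εstar a b) = 0) ∧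
      ∀ ε, 0 < γ a b ε ↔ ε < εstar a b := by
  have hb0 : 0 < b := by linarith [ha.2]
  exact sSup_pos_spec (continuous_γ ha.1 hb0) (antitone_γ ha.1 hb0) (γ_zero_pos ha hb)
    (γ_one_neg ha hb0)

/-! ### Almost sure growth rate by the strong law for blocks. -/

section StrongLaw

variable {a b : ℝ}

theorem abs_log_X_sub_sum_blocks (ha : 0 < a) (hb : 0 < b) (m q : ℕ) (ω : Noise) :
    |Real.log (X a b (q * m) ω) -
      ∑ i ∈ Finset.range q, Real.log (X a b m (shift ((i * m : ℕ) : ℤ) ω))| ≤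
      q * Real.log (quasiConst a b) := by
  induction q with
  | zero => simp [X_zero]
  | succ q ih =>
    have h := log_X_add ha hb (q * m) m ω
    rw [Finset.sum_range_succ, Nat.succ_mul]
    rw [abs_le] at ih ⊢
    push_cast at *
    constructor <;> linarith [ih.1, ih.2, h.1, h.2, log_quasiConst_nonneg (a := a) hb]

/-- Blocks of length `m` read disjoint windows of the noise, so they are independent and identically
distributed. -/
theorem ae_tendsto_blocks (ha : 0 < a) (hb : 0 < b) (ε : I) (m : ℕ) :
    ∀ᵐ ω ∂noiseLaw ε, Tendsto (fun q : ℕ =>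
      (∑ i ∈ Finset.range q, Real.log (X a b m (shift ((i * m : ℕ) : ℤ) ω))) / q) atTop
      (𝓝 (∫ ω, Real.log (X a b m ω) ∂noiseLaw ε)) := by
  have h := strong_law_ae_real (μ := noiseLaw ε)
    (fun (i : ℕ) ω => Real.log (X a b m (shift ((i * m : ℕ) : ℤ) ω))) ?_ ?_ ?_
  · simpa using h
  · simpa using integrable_log_X ha hb ε m
  · intro i j hij
    refine indepFun_of_dependsOn ε (dependsOn_shift (dependsOn_log_X m) _)
      (dependsOn_shift (dependsOn_log_X m) _) ?_
    rw [Finset.disjoint_left]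
    intro k hk hk'
    rw [Finset.mem_Ico] at hk hk'
    rcases Nat.lt_or_gt_of_ne hij with h | h
    · have := Nat.mul_le_mul_right m (Nat.succ_le_of_lt h)
      rw [Nat.succ_mul] at this
      omega
    · have := Nat.mul_le_mul_right m (Nat.succ_le_of_lt h)
      rw [Nat.succ_mul] at this
      omega
  · intro i
    refine ⟨((measurable_X m).log.comp (measurable_shift _)).aemeasurable,
      ((measurable_X m).log.comp (measurable_shift _)).aemeasurable, ?_⟩
    have key : ∀ k : ℤ, (noiseLaw ε).map (fun ω => Real.log (X a b m (shift k ω))) =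
        (noiseLaw ε).map (fun ω => Real.log (X a b m ω)) := by
      intro k
      conv_rhs => rw [← (measurePreserving_shift ε k).map_eq]
      rw [Measure.map_map (measurable_X m).log (measurable_shift k)]
      rfl
    rw [key, key]

theorem ae_tendsto_log_X (ha : 0 < a) (hb : 0 < b) (ε : I) :
    ∀ᵐ ω ∂noiseLaw ε, Tendsto (fun n : ℕ => (n : ℝ)⁻¹ * Real.log (X a b n ω)) atTop
      (𝓝 (γ a b ε)) := by
  have hall : ∀ᵐ ω ∂noiseLaw ε, ∀ m : ℕ, Tendsto (fun q : ℕ =>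
      (∑ i ∈ Finset.range q, Real.log (X a b m (shift ((i * m : ℕ) : ℤ) ω))) / q) atTop
      (𝓝 (∫ ω, Real.log (X a b m ω) ∂noiseLaw ε)) :=
    ae_all_iff.2 fun m => ae_tendsto_blocks ha hb ε m
  filter_upwards [hall] with ω hω
  set C := Real.log (quasiConst a b) with hC
  have hC0 : 0 ≤ C := log_quasiConst_nonneg hb
  rw [Metric.tendsto_atTop']
  intro δ hδ
  -- The error per block is `C` for splitting `log X` into blocks, `C` for replacing the block mean
  -- by `m * γ`, and `1` for the fluctuation in the law of large numbers.
  obtain ⟨m, hm0, hm⟩ : ∃ m : ℕ, 0 < m ∧ (2 * C + 1) / m < δ / 2 := by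
    have h0 := tendsto_const_div_atTop_nhds_zero_nat (2 * C + 1)
    exact ((eventually_gt_atTop 0).and (h0.eventually (gt_mem_nhds (half_pos hδ)))).exists
  have hm' : (0 : ℝ) < m := by exact_mod_cast hm0
  set e := ∫ ω, Real.log (X a b m ω) ∂noiseLaw ε with he
  have hq : ∀ᶠ q : ℕ in atTop, |∑ i ∈ Finset.range q,
      Real.log (X a b m (shift ((i * m : ℕ) : ℤ) ω)) - q * e| ≤ q := by
    filter_upwards [(hω m).eventually (Metric.ball_mem_nhds _ one_pos), eventually_gt_atTop 0]
      with q hq hq0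
    have hq' : (0 : ℝ) < q := by exact_mod_cast hq0
    rw [Real.dist_eq, ← he] at hq
    have : (∑ i ∈ Finset.range q, Real.log (X a b m (shift ((i * m : ℕ) : ℤ) ω))) / q - e =
      (∑ i ∈ Finset.range q, Real.log (X a b m (shift ((i * m : ℕ) : ℤ) ω)) - q * e) / q := by
      field_simp
    rw [this, abs_div, abs_of_pos hq', div_lt_one hq'] at hq
    exact hq.le
  have hdiv : Tendsto (fun n : ℕ => n / m) atTop atTop := Nat.tendsto_div_const_atTop hm0.ne'
  -- Contribution of the incomplete last block, bounded independently of `n`.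
  have hrest := tendsto_const_div_atTop_nhds_zero_nat (m * (logBound a b + |γ a b ε|))
  obtain ⟨N, hN⟩ := eventually_atTop.1 (((hdiv.eventually hq).and
    (hrest.eventually (gt_mem_nhds (half_pos hδ)))).and (eventually_gt_atTop 0))
  refine ⟨N, fun n hn => ?_⟩
  obtain ⟨⟨h1, h2⟩, hn0⟩ := hN n hn.le
  have hn' : (0 : ℝ) < n := by exact_mod_cast hn0
  set q := n / m
  set r := n % m
  have hnr : q * m + r = n := Nat.div_add_mod' n m
  have hr : r ≤ m := (Nat.mod_lt n hm0).le
  have hr' : (r : ℝ) ≤ m := by exact_mod_cast hr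
  have hnr' : (q : ℝ) * m + r = n := by exact_mod_cast hnr
  have e1 := abs_log_X_sub_sum_blocks ha hb m q ω
  have e2 := abs_log_X_add_sub ha hb (q * m) r ω
  rw [hnr] at e2
  have e3 := (γ_spec ha hb ε).2 m
  rw [← he, ← hC] at e3
  have e4 : |(q : ℝ) * e - q * (m * γ a b ε)| ≤ q * C := by
    rw [← mul_sub, abs_mul, Nat.abs_cast]
    refine mul_le_mul_of_nonneg_left ?_ q.cast_nonneg
    rw [abs_le]
    constructor <;> linarith [e3.1, e3.2]
  have e5 : |(r : ℝ) * γ a b ε| ≤ m * |γ a b ε| := by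
    rw [abs_mul, Nat.abs_cast]
    gcongr
  have e6 : (r : ℝ) * logBound a b ≤ m * logBound a b :=
    mul_le_mul_of_nonneg_right hr' logBound_nonneg
  have hsum : |Real.log (X a b n ω) - n * γ a b ε| ≤
      q * (2 * C + 1) + m * (logBound a b + |γ a b ε|) := by
    rw [← hnr']
    rw [abs_le] at *
    constructor <;> nlinarith [e1.1, e1.2, e2.1, e2.2, e4.1, e4.2, e5.1, e5.2, h1.1, h1.2]
  have heq : (n : ℝ)⁻¹ * Real.log (X a b n ω) - γ a b ε =
      (Real.log (X a b n ω) - n * γ a b ε) / n := by field_simp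
  rw [Real.dist_eq, heq, abs_div, abs_of_pos hn']
  have hqm : (q : ℝ) * (2 * C + 1) / n ≤ (2 * C + 1) / m := by
    rw [div_le_div_iff₀ hn' hm']
    have : (q : ℝ) * m ≤ n := by rw [← hnr']; linarith [(Nat.cast_nonneg r : (0 : ℝ) ≤ r)]
    nlinarith
  calc |Real.log (X a b n ω) - n * γ a b ε| / n
      ≤ (q * (2 * C + 1) + m * (logBound a b + |γ a b ε|)) / n := by gcongr
    _ = q * (2 * C + 1) / n + m * (logBound a b + |γ a b ε|) / n := add_div _ _ _
    _ < δ / 2 + δ / 2 := by linarith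
    _ = δ := add_halves δ

end StrongLaw

/-! ### Cumulant generating functions of bounded random variables. -/

section Cgf

variable {Ω : Type*} [MeasurableSpace Ω] {μ : Measure Ω} [IsProbabilityMeasure μ] {f g : Ω → ℝ}
  {K K' t : ℝ}

theorem integrable_exp_mul_of_bound (hf : AEMeasurable f μ) (hK : ∀ᵐ ω ∂μ, |f ω| ≤ K) (t : ℝ) :
    Integrable (fun ω => Real.exp (t * f ω)) μ := by
  refine .of_bound (hf.const_mul t).exp.aestronglyMeasurable (Real.exp (|t| * K)) ?_
  filter_upwards [hK] with ω hω
  rw [Real.norm_eq_abs, abs_of_pos (Real.exp_pos _), Real.exp_le_exp]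
  calc t * f ω ≤ |t * f ω| := le_abs_self _
    _ = |t| * |f ω| := abs_mul _ _
    _ ≤ |t| * K := by gcongr

theorem cgf_le_cgf (ht : 0 ≤ t) (hf : AEMeasurable f μ) (hK : ∀ᵐ ω ∂μ, |f ω| ≤ K)
    (hg : AEMeasurable g μ) (hK' : ∀ᵐ ω ∂μ, |g ω| ≤ K') (h : ∀ᵐ ω ∂μ, f ω ≤ g ω) :
    cgf f μ t ≤ cgf g μ t := by
  have hf' := integrable_exp_mul_of_bound hf hK t
  have hg' := integrable_exp_mul_of_bound hg hK' t
  refine Real.log_le_log (mgf_pos hf') (integral_mono_ae hf' hg' ?_)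
  filter_upwards [h] with ω hω
  gcongr

theorem cgf_add_const' (hf : AEMeasurable f μ) (hK : ∀ᵐ ω ∂μ, |f ω| ≤ K) (c t : ℝ) :
    cgf (fun ω => f ω + c) μ t = cgf f μ t + t * c := by
  rw [cgf, mgf_add_const, Real.log_mul (mgf_pos (integrable_exp_mul_of_bound hf hK t)).ne'
    (Real.exp_pos _).ne', Real.log_exp, cgf]

theorem abs_cgf_le (ht : 0 ≤ t) (hf : AEMeasurable f μ) (hK : ∀ᵐ ω ∂μ, |f ω| ≤ K) :
    |cgf f μ t| ≤ t * K := by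
  have h1 := cgf_le_cgf (g := fun _ => K) (K' := |K|) ht hf hK aemeasurable_const (by simp)
    (by filter_upwards [hK] with ω hω using (abs_le.1 hω).2)
  have h2 := cgf_le_cgf (f := fun _ => -K) (K := |K|) ht aemeasurable_const (by simp) hf hK
    (by filter_upwards [hK] with ω hω using (abs_le.1 hω).1)
  rw [cgf_const] at h1 h2
  rw [abs_le]
  constructor <;> linarith

theorem mem_interior_integrableExpSet (hf : AEMeasurable f μ) (hK : ∀ᵐ ω ∂μ, |f ω| ≤ K)
    (t : ℝ) : t ∈ interior (integrableExpSet f μ) := by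
  have : integrableExpSet f μ = univ :=
    eq_univ_of_forall fun s => integrable_exp_mul_of_bound hf hK s
  simp [this]

theorem convexOn_cgf (hf : AEMeasurable f μ) (hK : ∀ᵐ ω ∂μ, |f ω| ≤ K) :
    ConvexOn ℝ univ (cgf f μ) := by
  have hmem := mem_interior_integrableExpSet hf hK
  have han : ∀ t, AnalyticAt ℝ (cgf f μ) t := fun t => analyticAt_cgf (hmem t)
  refine convexOn_univ_of_deriv2_nonneg (fun t => (han t).differentiableAt)
    (fun t => (han t).deriv.differentiableAt) fun t => ?_
  rw [← iteratedDeriv_eq_iterate, iteratedDeriv_two_cgf_eq_integral (hmem t)]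
  exact div_nonneg (integral_nonneg fun ω => mul_nonneg (sq_nonneg _) (Real.exp_pos _).le)
    mgf_nonneg

theorem hasDerivAt_cgf_zero (hf : AEMeasurable f μ) (hK : ∀ᵐ ω ∂μ, |f ω| ≤ K) :
    HasDerivAt (cgf f μ) (∫ ω, f ω ∂μ) 0 := by
  have hmem := mem_interior_integrableExpSet hf hK 0
  have h := (analyticAt_cgf hmem).differentiableAt.hasDerivAt
  rwa [deriv_cgf_zero hmem, probReal_univ, div_one] at h

theorem mul_integral_le_cgf (hf : AEMeasurable f μ) (hK : ∀ᵐ ω ∂μ, |f ω| ≤ K) (t : ℝ) :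
    t * ∫ ω, f ω ∂μ ≤ cgf f μ t := by
  have hint : Integrable f μ := .of_bound hf.aestronglyMeasurable K hK
  have he := integrable_exp_mul_of_bound hf hK t
  set c := t * ∫ ω, f ω ∂μ with hc
  rw [cgf, Real.le_log_iff_exp_le (mgf_pos he)]
  -- Jensen's inequality through the tangent line of `exp` at `c`.
  have h : ∫ ω, Real.exp c * (t * f ω + (1 - c)) ∂μ ≤ mgf f μ t := by
    refine integral_mono (((hint.const_mul t).add (integrable_const _)).const_mul _) he fun ω => ?_
    have := Real.add_one_le_exp (t * f ω - c)
    rw [Real.exp_sub, le_div_iff₀ (Real.exp_pos c)] at this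
    simp only
    linarith
  rw [integral_const_mul, integral_add (hint.const_mul t) (integrable_const _),
    integral_const_mul, ← hc] at h
  simpa using h

end Cgf

/-! ### The moment exponent: existence, convexity, slope at zero, positive root. -/

section MomentExponent

variable {a b : ℝ}

/-- Minus the logarithm of `X n`. -/
noncomputable def negLogX (a b : ℝ) (n : ℕ) (ω : Noise) : ℝ := -Real.log (X a b n ω)

theorem measurable_negLogX (n : ℕ) : Measurable (negLogX a b n) := (measurable_X n).log.neg

theorem abs_negLogX_le (ha : 0 < a) (hb : 0 < b) (n : ℕ) (ω : Noise) :
    |negLogX a b n ω| ≤ n * logBound a b := by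
  rw [negLogX, abs_neg]
  exact abs_log_X_le ha hb n ω

theorem cgf_negLogX_comp_shift (ε : I) (n : ℕ) (m : ℤ) (t : ℝ) :
    cgf (fun ω => negLogX a b n (shift m ω)) (noiseLaw ε) t =
      cgf (negLogX a b n) (noiseLaw ε) t := by
  rw [cgf, cgf, mgf, mgf]
  congr 1
  exact integral_comp_shift ε m (f := fun ω => Real.exp (t * negLogX a b n ω))
    ((measurable_negLogX n).const_mul t).exp

theorem cgf_negLogX_add (ha : 0 < a) (hb : 0 < b) (ε : I) (m n : ℕ) (t : ℝ) :
    cgf (fun ω => negLogX a b m ω + negLogX a b n (shift m ω)) (noiseLaw ε) t =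
      cgf (negLogX a b m) (noiseLaw ε) t + cgf (negLogX a b n) (noiseLaw ε) t := by
  have hdep : ∀ n : ℕ, DependsOn (negLogX a b n) (Finset.Ico 0 (n : ℤ) : Set ℤ) :=
    fun n _ _ h => congrArg Neg.neg (dependsOn_log_X n h)
  have hind := indepFun_of_dependsOn ε (hdep m) (dependsOn_shift (hdep n) m) (by
    rw [Finset.disjoint_left]
    intro k hk hk'
    rw [Finset.mem_Ico] at hk hk'
    omega)
  have h := hind.cgf_add (t := t)
    (integrable_exp_mul_of_bound (measurable_negLogX m).aemeasurable
      (.of_forall (abs_negLogX_le ha hb m)) t)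
    (integrable_exp_mul_of_bound ((measurable_negLogX n).comp (measurable_shift m)).aemeasurable
      (.of_forall fun ω => abs_negLogX_le ha hb n (shift m ω)) t)
  rw [cgf_negLogX_comp_shift] at h
  exact h

theorem cgf_negLogX_almost_additive (ha : 0 < a) (hb : 0 < b) (ε : I) {t : ℝ} (ht : 0 ≤ t)
    (m n : ℕ) : cgf (negLogX a b (m + n)) (noiseLaw ε) t ≤
      cgf (negLogX a b m) (noiseLaw ε) t + cgf (negLogX a b n) (noiseLaw ε) t ∧
    cgf (negLogX a b m) (noiseLaw ε) t + cgf (negLogX a b n) (noiseLaw ε) t ≤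
      cgf (negLogX a b (m + n)) (noiseLaw ε) t + t * Real.log (quasiConst a b) := by
  rw [← cgf_negLogX_add ha hb ε m n t]
  have hm1 := (measurable_negLogX (a := a) (b := b) (m + n)).aemeasurable (μ := noiseLaw ε)
  have hm2 := ((measurable_negLogX (a := a) (b := b) m).add
    ((measurable_negLogX (a := a) (b := b) n).comp (measurable_shift m))).aemeasurable
    (μ := noiseLaw ε)
  have hb1 : ∀ᵐ ω ∂noiseLaw ε, |negLogX a b (m + n) ω| ≤ (m + n : ℕ) * logBound a b :=
    .of_forall (abs_negLogX_le ha hb _)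
  have hb2 : ∀ᵐ ω ∂noiseLaw ε, |negLogX a b m ω + negLogX a b n (shift m ω)| ≤
      m * logBound a b + n * logBound a b := .of_forall fun ω =>
    (abs_add_le _ _).trans (add_le_add (abs_negLogX_le ha hb _ _) (abs_negLogX_le ha hb _ _))
  have hb3 : ∀ᵐ ω ∂noiseLaw ε, |negLogX a b (m + n) ω + Real.log (quasiConst a b)| ≤
      (m + n : ℕ) * logBound a b + |Real.log (quasiConst a b)| := .of_forall fun ω =>
    (abs_add_le _ _).trans (add_le_add (abs_negLogX_le ha hb _ _) le_rfl)
  constructor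
  · refine cgf_le_cgf ht hm1 hb1 hm2 hb2 (.of_forall fun ω => ?_)
    have := (log_X_add ha hb m n ω).1
    simp only [negLogX]
    linarith
  · rw [← cgf_add_const' hm1 hb1]
    refine cgf_le_cgf ht hm2 hb2 (hm1.add_const _) hb3 (.of_forall fun ω => ?_)
    have := (log_X_add ha hb m n ω).2
    simp only [negLogX]
    linarith

theorem exp_mul_negLogX (ha : 0 < a) (hb : 0 < b) (n : ℕ) (t : ℝ) (ω : Noise) :
    Real.exp (t * negLogX a b n ω) = X a b n ω ^ (-t) := by
  rw [Real.rpow_def_of_pos (X_pos ha hb n ω), negLogX]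
  ring_nf

theorem log_integral_X_rpow (ha : 0 < a) (hb : 0 < b) (ε : I) (n : ℕ) (t : ℝ) :
    Real.log (∫ ω, X a b n ω ^ (-t) ∂noiseLaw ε) = cgf (negLogX a b n) (noiseLaw ε) t := by
  simp_rw [← exp_mul_negLogX ha hb]
  rfl

theorem log_prod_R_bounds (ha : 0 < a) (hb : 0 < b) {ω : Noise} (hω : ZerosInPast ω) (m : ℤ)
    (n : ℕ) : Real.log (∏ i ∈ Finset.range n, R a b (m + i) ω) ≤ negLogX a b n (shift m ω) ∧
      negLogX a b n (shift m ω) ≤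
        Real.log (∏ i ∈ Finset.range n, R a b (m + i) ω) + Real.log (quasiConst a b) := by
  have h := inv_prod_R_bounds ha hb hω m n
  have hX := X_pos ha hb n (shift m ω)
  have hP := prod_R_pos ha hb m n ω
  have hC := quasiConst_pos (a := a) hb
  have h1 := Real.log_le_log hX h.1
  have h2 := Real.log_le_log (inv_pos.2 hP) h.2
  rw [Real.log_inv] at h1 h2
  rw [Real.log_mul hC.ne' hX.ne'] at h2
  unfold negLogX
  constructor <;> linarith

theorem measurable_log_prod_R (m : ℤ) (n : ℕ) :
    Measurable fun ω => Real.log (∏ i ∈ Finset.range n, R a b (m + i) ω) :=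
  (Finset.measurable_prod _ fun _ _ => measurable_R _).log

theorem abs_log_prod_R_le (ha : 0 < a) (hb : 0 < b) {ω : Noise} (hω : ZerosInPast ω) (m : ℤ)
    (n : ℕ) : |Real.log (∏ i ∈ Finset.range n, R a b (m + i) ω)| ≤
      n * logBound a b + Real.log (quasiConst a b) := by
  have h := log_prod_R_bounds ha hb hω m n
  have h' := abs_le.1 (abs_negLogX_le ha hb n (shift m ω))
  rw [abs_le]
  constructor <;> linarith [h.1, h.2, h'.1, h'.2, log_quasiConst_nonneg (a := a) hb]

/-- Transfers the study of `Λ` from the ratios `R`, which are dependent, to `X`, whose blocks are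
independent. -/
theorem cgf_log_prod_R_bounds (ha : 0 < a) (hb : 0 < b) {ε : I} (hε : 0 < ε) {t : ℝ}
    (ht : 0 ≤ t) (m : ℤ) (n : ℕ) :
    cgf (fun ω => Real.log (∏ i ∈ Finset.range n, R a b (m + i) ω)) (noiseLaw ε) t ≤
        cgf (negLogX a b n) (noiseLaw ε) t ∧
      cgf (negLogX a b n) (noiseLaw ε) t ≤
        cgf (fun ω => Real.log (∏ i ∈ Finset.range n, R a b (m + i) ω)) (noiseLaw ε) t +
          t * Real.log (quasiConst a b) := by
  have hae := ae_zerosInPast hε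
  have hm1 := (measurable_log_prod_R (a := a) (b := b) m n).aemeasurable (μ := noiseLaw ε)
  have hb1 : ∀ᵐ ω ∂noiseLaw ε, |Real.log (∏ i ∈ Finset.range n, R a b (m + i) ω)| ≤
      n * logBound a b + Real.log (quasiConst a b) := by
    filter_upwards [hae] with ω hω using abs_log_prod_R_le ha hb hω m n
  have hm2 := ((measurable_negLogX (a := a) (b := b) n).comp (measurable_shift m)).aemeasurable
    (μ := noiseLaw ε)
  have hb2 : ∀ᵐ ω ∂noiseLaw ε, |negLogX a b n (shift m ω)| ≤ n * logBound a b :=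
    .of_forall fun ω => abs_negLogX_le ha hb n _
  have hb3 : ∀ᵐ ω ∂noiseLaw ε, |Real.log (∏ i ∈ Finset.range n, R a b (m + i) ω) +
      Real.log (quasiConst a b)| ≤
      n * logBound a b + Real.log (quasiConst a b) + |Real.log (quasiConst a b)| := by
    filter_upwards [hb1] with ω hω using (abs_add_le _ _).trans (add_le_add hω le_rfl)
  rw [← cgf_negLogX_comp_shift ε n m t]
  constructor
  · refine cgf_le_cgf ht hm1 hb1 hm2 hb2 ?_
    filter_upwards [hae] with ω hω using (log_prod_R_bounds ha hb hω m n).1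
  · rw [← cgf_add_const' hm1 hb1]
    refine cgf_le_cgf ht hm2 hb2 (hm1.add_const _) hb3 ?_
    filter_upwards [hae] with ω hω using (log_prod_R_bounds ha hb hω m n).2

theorem log_integral_prod_R (ha : 0 < a) (hb : 0 < b) (ε : I) (n : ℕ) (t : ℝ) :
    Real.log (∫ ω, ∏ k ∈ Finset.Icc 1 n, R a b (k : ℤ) ω ^ t ∂noiseLaw ε) =
      cgf (fun ω => Real.log (∏ i ∈ Finset.range n, R a b (1 + i) ω)) (noiseLaw ε) t := by
  rw [cgf, mgf]
  congr 2
  funext ω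
  have h : ∏ k ∈ Finset.Icc 1 n, R a b (k : ℤ) ω = ∏ i ∈ Finset.range n, R a b (1 + i) ω := by
    rw [← Finset.Ico_add_one_right_eq_Icc, Finset.prod_Ico_eq_prod_range]
    simp
  rw [Real.finsetProd_rpow _ _ (fun k _ => (R_pos ha hb _ ω).le), h,
    Real.rpow_def_of_pos (prod_R_pos ha hb 1 n ω), mul_comm]

theorem Λ_spec (ha : 0 < a) (hb : 0 < b) {ε : I} (hε : 0 < ε) {t : ℝ} (ht : 0 ≤ t) :
    Tendsto (fun n : ℕ => (n : ℝ)⁻¹ * Real.log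
        (∫ ω, ∏ k ∈ Finset.Icc 1 n, R a b (k : ℤ) ω ^ t ∂noiseLaw ε)) atTop (𝓝 (Λ a b ε t)) ∧
      Tendsto (fun n : ℕ => (n : ℝ)⁻¹ * cgf (negLogX a b n) (noiseLaw ε) t) atTop
        (𝓝 (Λ a b ε t)) ∧
      ∀ n : ℕ, n * Λ a b ε t ≤ cgf (negLogX a b n) (noiseLaw ε) t ∧
        cgf (negLogX a b n) (noiseLaw ε) t ≤ n * Λ a b ε t + t * Real.log (quasiConst a b) := by
  obtain ⟨L, hL, hL'⟩ := exists_tendsto_of_almost_additive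
    (u := fun n => cgf (negLogX a b n) (noiseLaw ε) t)
    (mul_nonneg ht (log_quasiConst_nonneg (a := a) hb))
    (mul_nonneg ht (logBound_nonneg (a := a) (b := b))) (fun n => by
      have := abs_cgf_le ht (measurable_negLogX (a := a) (b := b) n).aemeasurable
        (μ := noiseLaw ε) (.of_forall (abs_negLogX_le ha hb n))
      linarith) (cgf_negLogX_almost_additive ha hb ε ht)
  have hR : Tendsto (fun n : ℕ => (n : ℝ)⁻¹ * Real.log
      (∫ ω, ∏ k ∈ Finset.Icc 1 n, R a b (k : ℤ) ω ^ t ∂noiseLaw ε)) atTop (𝓝 L) := by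
    have h0 := tendsto_const_div_atTop_nhds_zero_nat (t * Real.log (quasiConst a b))
    have hlow := hL.sub h0
    rw [sub_zero] at hlow
    refine tendsto_of_tendsto_of_tendsto_of_le_of_le hlow hL (fun n => ?_) fun n => ?_
    · have h := (cgf_log_prod_R_bounds ha hb hε ht 1 n).2
      simp only
      rw [log_integral_prod_R ha hb, div_eq_inv_mul, ← mul_sub]
      exact mul_le_mul_of_nonneg_left (by linarith) (by positivity)
    · have h := (cgf_log_prod_R_bounds ha hb hε ht 1 n).1
      simp only
      rw [log_integral_prod_R ha hb]
      exact mul_le_mul_of_nonneg_left h (by positivity)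
  have hΛ : Λ a b ε t = L := hR.limUnder_eq
  rw [hΛ]
  exact ⟨hR, hL, hL'⟩

theorem Λ_zero (ha : 0 < a) (hb : 0 < b) {ε : I} (hε : 0 < ε) : Λ a b ε 0 = 0 := by
  refine tendsto_nhds_unique (Λ_spec ha hb hε le_rfl).2.1 ?_
  simp

theorem convexOn_Λ (ha : 0 < a) (hb : 0 < b) {ε : I} (hε : 0 < ε) :
    ConvexOn ℝ (Ici 0) (Λ a b ε) := by
  refine ⟨convex_Ici 0, fun s hs t ht p q hp hq hpq => ?_⟩
  have hst : 0 ≤ p • s + q • t := convex_Ici 0 hs ht hp hq hpq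
  refine le_of_tendsto_of_tendsto' (Λ_spec ha hb hε hst).2.1
    (((Λ_spec ha hb hε hs).2.1.const_smul p).add ((Λ_spec ha hb hε ht).2.1.const_smul q))
    fun n => ?_
  have h := (convexOn_cgf (μ := noiseLaw ε) (measurable_negLogX (a := a) (b := b) n).aemeasurable
    (.of_forall (abs_negLogX_le ha hb n))).2 (mem_univ s) (mem_univ t) hp hq hpq
  simp only [smul_eq_mul] at h ⊢
  refine (mul_le_mul_of_nonneg_left h (by positivity)).trans_eq ?_
  ring

theorem integral_negLogX (ε : I) (n : ℕ) :
    ∫ ω, negLogX a b n ω ∂noiseLaw ε = -∫ ω, Real.log (X a b n ω) ∂noiseLaw ε :=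
  integral_neg _

theorem neg_mul_γ_le_Λ (ha : 0 < a) (hb : 0 < b) {ε : I} (hε : 0 < ε) {t : ℝ} (ht : 0 ≤ t) :
    -(t * γ a b ε) ≤ Λ a b ε t := by
  refine le_of_tendsto_of_tendsto' ((γ_spec ha hb ε).1.const_mul t).neg
    (Λ_spec ha hb hε ht).2.1 fun n => ?_
  have h := mul_integral_le_cgf (measurable_negLogX (a := a) (b := b) n).aemeasurable
    (μ := noiseLaw ε) (.of_forall (abs_negLogX_le ha hb n)) t
  rw [integral_negLogX] at h
  refine le_trans (le_of_eq ?_) (mul_le_mul_of_nonneg_left h (by positivity))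
  ring

/-- Jensen's inequality gives `Λ t / t ≥ -γ`. For the upper bound, `n * Λ t` is at most the
generating function at time `n`, whose derivative at `0` is at most `-n * γ + log (quasiConst a b)`;
dividing by a large fixed `n` removes the constant. -/
theorem hasDerivWithinAt_Λ (ha : 0 < a) (hb : 0 < b) {ε : I} (hε : 0 < ε) :
    HasDerivWithinAt (Λ a b ε) (-γ a b ε) (Ici 0) 0 := by
  rw [hasDerivWithinAt_iff_tendsto_slope, Ici_sdiff_left, tendsto_order]
  have hslope : ∀ t, slope (Λ a b ε) 0 t = Λ a b ε t / t := fun t => by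
    simp [slope_def_field, Λ_zero ha hb hε]
  constructor
  · intro l hl
    filter_upwards [self_mem_nhdsWithin] with t ht
    have ht' : 0 < t := ht
    refine hl.trans_le ?_
    rw [hslope, le_div_iff₀ ht']
    have := neg_mul_γ_le_Λ ha hb hε ht'.le
    linarith
  · intro l hl
    set C := Real.log (quasiConst a b) with hC
    obtain ⟨n, hn0, hn⟩ : ∃ n : ℕ, 0 < n ∧ C / n < l + γ a b ε :=
      ((eventually_gt_atTop 0).and ((tendsto_const_div_atTop_nhds_zero_nat C).eventually
        (gt_mem_nhds (by linarith)))).exists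
    have hn' : (0 : ℝ) < n := by exact_mod_cast hn0
    have hd := hasDerivAt_cgf_zero (measurable_negLogX (a := a) (b := b) n).aemeasurable
      (μ := noiseLaw ε) (.of_forall (abs_negLogX_le ha hb n))
    have hd' := hasDerivWithinAt_iff_tendsto_slope.1 (hd.hasDerivWithinAt (s := Ici 0))
    rw [Ici_sdiff_left, integral_negLogX] at hd'
    have hlt : -∫ ω, Real.log (X a b n ω) ∂noiseLaw ε < n * l := by
      have h := ((γ_spec ha hb ε).2 n).2
      rw [div_lt_iff₀ hn'] at hn
      linarith
    filter_upwards [hd'.eventually (gt_mem_nhds hlt), self_mem_nhdsWithin] with t ht ht0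
    have ht0' : 0 < t := ht0
    have h := ((Λ_spec ha hb hε ht0'.le).2.2 n).1
    rw [slope_def_field, cgf_zero, sub_zero, sub_zero, div_lt_iff₀ ht0'] at ht
    rw [hslope, div_lt_iff₀ ht0']
    have : n * Λ a b ε t < n * (l * t) := by linarith
    exact lt_of_mul_lt_mul_left this hn'.le

/-- With probability `ε ^ n` the first `n` symbols are all zero and `X n = a ^ n`, so the moment of
order `-t` is at least `ε ^ n * a ^ (-n * t)`. For `a < 1` this bound tends to infinity with `t`. -/
theorem log_sub_le_Λ (ha : 0 < a) (hb : 0 < b) {ε : I} (hε : 0 < ε) {t : ℝ} (ht : 0 ≤ t) :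
    Real.log ε - t * Real.log a ≤ Λ a b ε t := by
  have hε' : (0 : ℝ) < ε := hε
  refine ge_of_tendsto (Λ_spec ha hb hε ht).2.1 ?_
  filter_upwards [eventually_gt_atTop 0] with n hn
  have hn' : (0 : ℝ) < n := by exact_mod_cast hn
  rw [← div_eq_inv_mul, le_div_iff₀ hn']
  have hint := integrable_exp_mul_of_bound (measurable_negLogX (a := a) (b := b) n).aemeasurable
    (μ := noiseLaw ε) (.of_forall (abs_negLogX_le ha hb n)) t
  rw [cgf, Real.le_log_iff_exp_le (mgf_pos hint)]
  refine le_trans ?_ (mul_meas_ge_le_integral_of_nonneg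
    (.of_forall fun ω => (Real.exp_pos _).le) hint (Real.exp (-(n * (t * Real.log a)))))
  have hset : (ε : ℝ) ^ n ≤ (noiseLaw ε).real
      {ω | Real.exp (-(n * (t * Real.log a))) ≤ Real.exp (t * negLogX a b n ω)} := by
    have h := noiseLaw_forall_mem_eq ε (Finset.Ico 0 (n : ℤ)) false
    rw [bernoulli_false, Int.card_Ico, sub_zero, Int.toNat_natCast] at h
    have h' : (noiseLaw ε).real {ω | ∀ k ∈ Finset.Ico 0 (n : ℤ), ω k = false} = (ε : ℝ) ^ n := by
      rw [measureReal_def, h, ENNReal.toReal_pow, ENNReal.toReal_ofReal hε'.le]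
    rw [← h']
    refine measureReal_mono fun ω hω => ?_
    have hX : X a b n ω = a ^ n :=
      X_of_forall_false fun k hk hk' => hω k (Finset.mem_Ico.2 ⟨hk, hk'⟩)
    change Real.exp _ ≤ Real.exp _
    rw [negLogX, hX, Real.log_pow]
    exact le_of_eq (by ring_nf)
  calc Real.exp ((Real.log ε - t * Real.log a) * n)
      = Real.exp (-(n * (t * Real.log a))) * (ε : ℝ) ^ n := by
        rw [← Real.exp_log (pow_pos hε' n), ← Real.exp_add, Real.log_pow]
        ring_nf
    _ ≤ _ := by gcongr

theorem eventually_neg_of_hasDerivWithinAt {f : ℝ → ℝ} {f' : ℝ} (h0 : f 0 = 0)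
    (hd : HasDerivWithinAt f f' (Ici 0) 0) (hf' : f' < 0) : ∀ᶠ t in 𝓝[>] (0 : ℝ), f t < 0 := by
  have hs := hasDerivWithinAt_iff_tendsto_slope.1 hd
  rw [Ici_sdiff_left] at hs
  filter_upwards [hs.eventually (gt_mem_nhds hf'), self_mem_nhdsWithin] with t ht ht0
  have ht0' : 0 < t := ht0
  rwa [slope_def_field, h0, sub_zero, sub_zero, div_lt_iff₀ ht0', zero_mul] at ht

theorem existsUnique_zero_iff {f : ℝ → ℝ} {g : ℝ} (hf : ConvexOn ℝ (Ici 0) f) (h0 : f 0 = 0)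
    (hd : HasDerivWithinAt f (-g) (Ici 0) 0) (hlow : ∀ t, 0 ≤ t → -(t * g) ≤ f t)
    (htop : ∃ T, 0 < T ∧ ∀ t, T ≤ t → 0 < f t) :
    0 < g ↔ ∃! s : ℝ, 0 < s ∧ f s = 0 := by
  constructor
  · intro hg
    have hneg := eventually_neg_of_hasDerivWithinAt h0 hd (neg_neg_of_pos hg)
    obtain ⟨T, hT, hTpos⟩ := htop
    -- Convexity gives continuity in the interior only; at the endpoint it comes from the one-sided
    -- derivative.
    have hcont : ContinuousOn f (Ici 0) := hf.continuousOn_Ici hd.continuousWithinAt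
    obtain ⟨t, ht, htIoo⟩ := (hneg.and (Ioo_mem_nhdsGT hT)).exists
    obtain ⟨s, hs, hs0⟩ := intermediate_value_Icc htIoo.2.le
      (hcont.mono fun x hx => htIoo.1.le.trans hx.1) ⟨ht.le, (hTpos T le_rfl).le⟩
    -- Two zeros are impossible: from a negative value to the left of `s₁` the slope is positive,
    -- then it would drop to `0` between `s₁` and `s₂`.
    have key : ∀ s₁ s₂, 0 < s₁ → s₁ < s₂ → f s₁ = 0 → f s₂ = 0 → False := by
      intro s₁ s₂ h1 h12 e1 e2
      obtain ⟨r, hr, hrIoo⟩ := (hneg.and (Ioo_mem_nhdsGT h1)).exists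
      have h := hf.slope_mono_adjacent (x := r) (y := s₁) (z := s₂) hrIoo.1.le
        (h1.le.trans h12.le) hrIoo.2 h12
      rw [e1, e2, sub_zero, zero_div, zero_sub] at h
      have : 0 < -f r / (s₁ - r) := div_pos (by linarith) (by linarith [hrIoo.2])
      linarith
    refine ⟨s, ⟨htIoo.1.trans_le hs.1, hs0⟩, fun s' hs' => ?_⟩
    rcases lt_trichotomy s' s with h | h | h
    · exact (key s' s hs'.1 h hs'.2 hs0).elim
    · exact h
    · exact (key s s' (htIoo.1.trans_le hs.1) h hs0 hs'.2).elim
  · rintro ⟨s, ⟨hs, hs0⟩, huniq⟩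
    by_contra! hg
    -- If `g ≤ 0` then `f ≥ 0`, while convexity gives `f (s / 2) ≤ 0`, so `s / 2` would be a second
    -- zero.
    have hnn : 0 ≤ f (s / 2) := by
      have := hlow (s / 2) (by linarith)
      have : s / 2 * g ≤ 0 := mul_nonpos_of_nonneg_of_nonpos (by linarith) hg
      linarith
    have hle := hf.2 (mem_Ici.2 le_rfl) (mem_Ici.2 hs.le) (show (0 : ℝ) ≤ 1 / 2 by norm_num)
      (show (0 : ℝ) ≤ 1 / 2 by norm_num) (by norm_num)
    rw [h0, hs0] at hle
    simp only [smul_eq_mul, mul_zero, add_zero, zero_add] at hle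
    rw [one_div_mul_eq_div] at hle
    have := huniq (s / 2) ⟨by linarith, le_antisymm hle hnn⟩
    linarith

theorem existsUnique_Λ_zero_iff (ha : a ∈ Ioo (0 : ℝ) 1) (hb : 0 < b) {ε : I} (hε : 0 < ε) :
    0 < γ a b ε ↔ ∃! s : ℝ, 0 < s ∧ Λ a b ε s = 0 := by
  refine existsUnique_zero_iff (convexOn_Λ ha.1 hb hε) (Λ_zero ha.1 hb hε)
    (hasDerivWithinAt_Λ ha.1 hb hε) (fun t ht => neg_mul_γ_le_Λ ha.1 hb hε ht) ?_
  have hla : Real.log a < 0 := Real.log_neg ha.1 ha.2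
  have ht : Tendsto (fun t : ℝ => Real.log ε - t * Real.log a) atTop atTop := by
    have : Tendsto (fun t : ℝ => Real.log ε + t * (-Real.log a)) atTop atTop :=
      tendsto_atTop_add_const_left _ _ (tendsto_id.atTop_mul_const (by linarith))
    simpa [sub_eq_add_neg] using this
  obtain ⟨T, hT⟩ := eventually_atTop.1 (ht.eventually (eventually_gt_atTop 0))
  exact ⟨max T 1, by positivity, fun t h => (hT t ((le_max_left _ _).trans h)).trans_le
    (log_sub_le_Λ ha.1 hb hε (by linarith [(le_max_right T 1).trans h]))⟩

end MomentExponent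

/-! ### Finiteness and non-degeneracy of the series `W`. -/

section Perpetuity

variable {a b : ℝ}

/-- The summands of the series `W`. -/
noncomputable def termW (a b : ℝ) (k : ℕ) (ω : Noise) : ℝ :=
  ∏ j ∈ Finset.range (k + 1), R a b (-(j : ℤ)) ω

theorem termW_pos (ha : 0 < a) (hb : 0 < b) (k : ℕ) (ω : Noise) : 0 < termW a b k ω :=
  Finset.prod_pos fun _ _ => R_pos ha hb _ _

theorem termW_eq (k : ℕ) (ω : Noise) :
    termW a b k ω = ∏ i ∈ Finset.range (k + 1), R a b (-(k : ℤ) + i) ω := by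
  rw [termW, ← Finset.prod_range_reflect]
  refine Finset.prod_congr rfl fun j hj => ?_
  rw [Finset.mem_range] at hj
  congr 1
  omega

theorem W_eq_tsum (ω : Noise) : W a b ω = ∑' k, ENNReal.ofReal (termW a b k ω) := rfl

theorem W_shift_one (ha : 0 < a) (hb : 0 < b) (ω : Noise) :
    W a b (shift 1 ω) = ENNReal.ofReal (R a b 1 ω) * (1 + W a b ω) := by
  have h : ∀ k, ENNReal.ofReal (termW a b k (shift 1 ω)) = ENNReal.ofReal (R a b 1 ω) *
      ENNReal.ofReal (∏ j ∈ Finset.range k, R a b (-(j : ℤ)) ω) := by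
    intro k
    rw [← ENNReal.ofReal_mul (R_pos ha hb 1 ω).le, termW, Finset.prod_range_succ']
    simp only [R_shift]
    rw [mul_comm]
    congr 2
    refine Finset.prod_congr rfl fun j _ => ?_
    congr 1
    push_cast
    ring
  rw [W_eq_tsum, tsum_congr h, ENNReal.tsum_mul_left, tsum_eq_zero_add' ENNReal.summable]
  simp [W]

theorem ofReal_R_le_W (ω : Noise) : ENNReal.ofReal (R a b 0 ω) ≤ W a b ω := by
  have := ENNReal.le_tsum (f := fun k => ENNReal.ofReal (termW a b k ω)) 0
  simpa [termW, W] using this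

theorem ae_W_lt_top (ha : 0 < a) (hb : 0 < b) {ε : I} (hε : 0 < ε) (hγ : 0 < γ a b ε) :
    ∀ᵐ ω ∂noiseLaw ε, W a b ω < ∞ := by
  -- `Λ s < 0` makes the `s`-th moments summable; `s < 1` gives `termW ≤ termW ^ s` once the terms
  -- are below `1`.
  obtain ⟨s, hneg, hs0, hs1⟩ := ((eventually_neg_of_hasDerivWithinAt (Λ_zero ha hb hε)
    (hasDerivWithinAt_Λ ha hb hε) (neg_neg_of_pos hγ)).and (Ioo_mem_nhdsGT one_pos)).exists
  set C := Real.log (quasiConst a b)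
  have hint : ∀ k : ℕ, Integrable (fun ω => termW a b k ω ^ s) (noiseLaw ε) ∧
      ∫ ω, termW a b k ω ^ s ∂noiseLaw ε ≤
        Real.exp (s * C) * Real.exp (Λ a b ε s) ^ (k + 1) := by
    intro k
    have hm := (measurable_log_prod_R (a := a) (b := b) (-(k : ℤ)) (k + 1)).aemeasurable
      (μ := noiseLaw ε)
    have hbd : ∀ᵐ ω ∂noiseLaw ε,
        |Real.log (∏ i ∈ Finset.range (k + 1), R a b (-(k : ℤ) + i) ω)| ≤
          (k + 1 : ℕ) * logBound a b + C := by
      filter_upwards [ae_zerosInPast hε] with ω hω using abs_log_prod_R_le ha hb hω _ _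
    have he : (fun ω => termW a b k ω ^ s) = fun ω =>
        Real.exp (s * Real.log (∏ i ∈ Finset.range (k + 1), R a b (-(k : ℤ) + i) ω)) := by
      funext ω
      rw [termW_eq, Real.rpow_def_of_pos (prod_R_pos ha hb _ _ ω), mul_comm]
    have hi := integrable_exp_mul_of_bound hm hbd s
    rw [he]
    refine ⟨hi, ?_⟩
    have h1 := (cgf_log_prod_R_bounds ha hb hε hs0.le (-(k : ℤ)) (k + 1)).1
    have h2 := ((Λ_spec ha hb hε hs0.le).2.2 (k + 1)).2
    have h3 := h1.trans h2
    rw [cgf, Real.log_le_iff_le_exp (mgf_pos hi)] at h3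
    refine h3.trans_eq ?_
    rw [← Real.exp_nat_mul, ← Real.exp_add, add_comm]
  have hfin : ∫⁻ ω, ∑' k, ENNReal.ofReal (termW a b k ω ^ s) ∂noiseLaw ε ≠ ∞ := by
    have hmeas : ∀ k, Measurable fun ω => ENNReal.ofReal (termW a b k ω ^ s) := fun k =>
      ((Finset.measurable_prod _ fun _ _ => measurable_R _).pow_const s).ennreal_ofReal
    rw [lintegral_tsum fun k => (hmeas k).aemeasurable]
    have hle : ∀ k, ∫⁻ ω, ENNReal.ofReal (termW a b k ω ^ s) ∂noiseLaw ε ≤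
        ENNReal.ofReal (Real.exp (s * C) * Real.exp (Λ a b ε s) ^ (k + 1)) := by
      intro k
      rw [← ofReal_integral_eq_lintegral_ofReal (hint k).1
        (.of_forall fun ω => Real.rpow_nonneg (termW_pos ha hb k ω).le s)]
      exact ENNReal.ofReal_le_ofReal (hint k).2
    refine ne_top_of_le_ne_top ?_ (ENNReal.tsum_le_tsum hle)
    have hsum : Summable fun k : ℕ => Real.exp (s * C) * Real.exp (Λ a b ε s) ^ (k + 1) :=
      ((summable_nat_add_iff 1).2 (summable_geometric_of_lt_one (Real.exp_pos _).le
        (Real.exp_lt_one_iff.2 hneg))).mul_left _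
    exact hsum.tsum_ofReal_ne_top
  have hae := ae_lt_top' (Measurable.tsum fun k =>
    ((Finset.measurable_prod _ fun _ _ => measurable_R _).pow_const s).ennreal_ofReal).aemeasurable
    hfin
  filter_upwards [hae] with ω hω
  have hnn : ∀ k, 0 ≤ termW a b k ω ^ s := fun k => Real.rpow_nonneg (termW_pos ha hb k ω).le s
  have hs : Summable fun k => termW a b k ω ^ s := by
    refine (ENNReal.summable_toReal hω.ne).congr fun k => ?_
    exact ENNReal.toReal_ofReal (hnn k)
  have hs' : Summable fun k => termW a b k ω := by
    refine hs.of_norm_bounded_eventually_nat ?_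
    filter_upwards [hs.tendsto_atTop_zero.eventually (gt_mem_nhds one_pos)] with k hk
    have hp := termW_pos ha hb k ω
    rw [Real.norm_eq_abs, abs_of_pos hp]
    have h1 : termW a b k ω ≤ 1 := by
      by_contra! h
      exact absurd hk (not_lt.2 (Real.one_le_rpow h.le hs0.le))
    simpa using Real.rpow_le_rpow_of_exponent_ge hp h1 hs1.le
  exact hs'.tsum_ofReal_ne_top.lt_top

/-- A coboundary bounded below has nonpositive mean. -/
theorem lintegral_coboundary_le {Ω : Type*} [MeasurableSpace Ω] {μ : Measure Ω}
    [IsProbabilityMeasure μ] {T : Ω → Ω} (hT : MeasurePreserving T μ μ) {f : Ω → ℝ}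
    (hf : Measurable f) {K : ℝ} (hK : 0 ≤ K) (h : ∀ᵐ ω ∂μ, -K ≤ f (T ω) - f ω) :
    ∫⁻ ω, ENNReal.ofReal (f (T ω) - f ω + K) ∂μ ≤ ENNReal.ofReal K := by
  -- `f` need not be integrable. Truncations at level `N` are, their coboundaries have mean zero and
  -- keep the lower bound `-K`, and Fatou's lemma passes to the limit.
  set c : ℕ → ℝ → ℝ := fun N x => max (-N) (min x N) with hc
  have hcm : ∀ N, Measurable fun ω => c N (f ω) := fun N =>
    measurable_const.max (hf.min measurable_const)
  have hcmT : ∀ N, Measurable fun ω => c N (f (T ω)) := fun N => (hcm N).comp hT.measurable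
  have hci : ∀ N, Integrable (fun ω => c N (f ω)) μ := fun N =>
    .of_bound (hcm N).aestronglyMeasurable N (.of_forall fun ω => by
      have : (0 : ℝ) ≤ N := N.cast_nonneg
      rw [Real.norm_eq_abs, abs_le]
      exact ⟨le_max_left _ _, max_le (by linarith) (min_le_right _ _)⟩)
  have hciT : ∀ N, Integrable (fun ω => c N (f (T ω))) μ := fun N =>
    hT.integrable_comp_of_integrable (hci N)
  have hcid : ∀ N, Integrable (fun ω => c N (f (T ω)) - c N (f ω)) μ := fun N =>
    (hciT N).sub (hci N)
  have hzero : ∀ N, ∫⁻ ω, ENNReal.ofReal (c N (f (T ω)) - c N (f ω) + K) ∂μ =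
      ENNReal.ofReal K := by
    intro N
    rw [← ofReal_integral_eq_lintegral_ofReal]
    · rw [integral_add (hcid N) (integrable_const K), integral_sub (hciT N) (hci N)]
      have : ∫ ω, c N (f (T ω)) ∂μ = ∫ ω, c N (f ω) ∂μ := by
        conv_rhs => rw [← hT.map_eq]
        rw [integral_map hT.measurable.aemeasurable (hcm N).aestronglyMeasurable]
      simp [this]
    · exact (hcid N).add (integrable_const K)
    · filter_upwards [h] with ω hω
      have hle : c N (f ω) ≤ c N (f (T ω)) + K := by
        simp only [hc]
        rw [max_le_iff]
        refine ⟨by linarith [le_max_left (-(N : ℝ)) (min (f (T ω)) N)], ?_⟩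
        refine le_trans ?_ (add_le_add_left (le_max_right _ _) K)
        rw [← min_add_add_right]
        exact min_le_min (by linarith) (by linarith)
      simp only [Pi.zero_apply]
      linarith
  have hlim : ∀ x : ℝ, ∀ᶠ N : ℕ in atTop, c N x = x := by
    intro x
    filter_upwards [eventually_ge_atTop ⌈|x|⌉₊] with N hN
    have hN' : |x| ≤ N := (Nat.le_ceil _).trans (by exact_mod_cast hN)
    rw [abs_le] at hN'
    simp only [hc]
    rw [min_eq_left hN'.2, max_eq_right hN'.1]
  calc ∫⁻ ω, ENNReal.ofReal (f (T ω) - f ω + K) ∂μ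
      = ∫⁻ ω, liminf (fun N => ENNReal.ofReal (c N (f (T ω)) - c N (f ω) + K)) atTop ∂μ := by
        refine lintegral_congr fun ω => ?_
        symm
        refine Tendsto.liminf_eq (tendsto_const_nhds.congr' ?_)
        filter_upwards [hlim (f ω), hlim (f (T ω))] with N h1 h2
        rw [h1, h2]
    _ ≤ liminf (fun N => ∫⁻ ω, ENNReal.ofReal (c N (f (T ω)) - c N (f ω) + K) ∂μ) atTop :=
        lintegral_liminf_le fun N => (((hcmT N).sub (hcm N)).add_const K).ennreal_ofReal
    _ = ENNReal.ofReal K := by simp [hzero]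

theorem integrable_log_R (ha : 0 < a) (hb : 0 < b) {ε : I} (hε : 0 < ε) (n : ℤ) :
    Integrable (fun ω => Real.log (R a b n ω)) (noiseLaw ε) := by
  refine .of_bound (measurable_R n).log.aestronglyMeasurable (logBound a b) ?_
  filter_upwards [ae_zerosInPast hε] with ω hω using abs_log_R_le ha hb hω n

theorem neg_γ_le_integral_log_R (ha : 0 < a) (hb : 0 < b) {ε : I} (hε : 0 < ε) :
    -γ a b ε ≤ ∫ ω, Real.log (R a b 1 ω) ∂noiseLaw ε := by
  set e := ∫ ω, Real.log (R a b 1 ω) ∂noiseLaw ε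
  set C := Real.log (quasiConst a b)
  have key : ∀ n : ℕ, -(n * γ a b ε) ≤ n * e + C := by
    intro n
    have h1 : ∫ ω, Real.log (∏ i ∈ Finset.range n, R a b (1 + i) ω) ∂noiseLaw ε = n * e := by
      have : ∀ ω, Real.log (∏ i ∈ Finset.range n, R a b (1 + i) ω) =
          ∑ i ∈ Finset.range n, Real.log (R a b (1 + i) ω) := fun ω =>
        Real.log_prod fun i _ => (R_pos ha hb _ ω).ne'
      simp_rw [this]
      rw [integral_finsetSum _ fun i _ => integrable_log_R ha hb hε _]
      have hi : ∀ i : ℕ, ∫ ω, Real.log (R a b (1 + i) ω) ∂noiseLaw ε = e := fun i => by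
        have := integral_comp_shift ε i (measurable_R (a := a) (b := b) 1).log
        simpa only [R_shift] using this
      simp [hi]
    have hint : Integrable (fun ω => Real.log (∏ i ∈ Finset.range n, R a b (1 + i) ω))
        (noiseLaw ε) := by
      refine .of_bound (measurable_log_prod_R 1 n).aestronglyMeasurable
        (n * logBound a b + Real.log (quasiConst a b)) ?_
      filter_upwards [ae_zerosInPast hε] with ω hω using abs_log_prod_R_le ha hb hω 1 n
    have h2 := integral_mono_ae (μ := noiseLaw ε) (integrable_log_X_shift ha hb ε n 1).neg
      (hint.add (integrable_const C)) (by
        filter_upwards [ae_zerosInPast hε] with ω hω using (log_prod_R_bounds ha hb hω 1 n).2)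
    simp only [Pi.neg_apply, Pi.add_apply] at h2
    rw [integral_neg, integral_comp_shift ε 1 (measurable_X n).log,
      integral_add hint (integrable_const C), h1] at h2
    simp only [integral_const, probReal_univ, one_smul] at h2
    have h3 := ((γ_spec ha hb ε).2 n).1
    linarith
  by_contra! hlt
  obtain ⟨n, hn⟩ := exists_nat_gt (C / (-γ a b ε - e))
  rw [div_lt_iff₀ (by linarith)] at hn
  linarith [key n]

/-- By `W_shift_one`, the coboundary of `log W` is `log (R 1) + log ((1 + W) / W)` with a strictly
positive second summand. Its mean is at most `0`, so `log (R 1)` has negative mean, and this mean is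
at least `-γ`. -/
theorem γ_pos_of_ae_W_lt_top (ha : 0 < a) (hb : 0 < b) {ε : I} (hε : 0 < ε)
    (hW : ∀ᵐ ω ∂noiseLaw ε, W a b ω < ∞) : 0 < γ a b ε := by
  set K := logBound a b
  have hK : 0 ≤ K := logBound_nonneg
  set w : Noise → ℝ := fun ω => (W a b ω).toReal
  have hwm : Measurable w := measurable_W.ennreal_toReal
  have hw : ∀ᵐ ω ∂noiseLaw ε, 0 < w ω ∧
      Real.log (w (shift 1 ω)) - Real.log (w ω) =
        Real.log (R a b 1 ω) + Real.log ((1 + w ω) / w ω) := by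
    filter_upwards [hW] with ω hω
    have hpos : 0 < w ω := ENNReal.toReal_pos
      (ne_of_gt (lt_of_lt_of_le (ENNReal.ofReal_pos.2 (R_pos ha hb 0 ω)) (ofReal_R_le_W ω))) hω.ne
    have hR := R_pos ha hb 1 ω
    have hs : w (shift 1 ω) = R a b 1 ω * (1 + w ω) := by
      simp only [w]
      rw [W_shift_one ha hb, ENNReal.toReal_mul, ENNReal.toReal_ofReal hR.le,
        ENNReal.toReal_add ENNReal.one_ne_top hω.ne, ENNReal.toReal_one]
    refine ⟨hpos, ?_⟩
    rw [hs, Real.log_mul hR.ne' (by linarith), Real.log_div (by linarith) hpos.ne']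
    ring
  have hg : ∀ᵐ ω ∂noiseLaw ε, 0 < Real.log ((1 + w ω) / w ω) := by
    filter_upwards [hw] with ω hω
    refine Real.log_pos ?_
    rw [lt_div_iff₀ hω.1]
    linarith
  have hlogR : ∀ᵐ ω ∂noiseLaw ε, -K ≤ Real.log (R a b 1 ω) := by
    filter_upwards [ae_zerosInPast hε] with ω hω using (abs_le.1 (abs_log_R_le ha hb hω 1)).1
  have hcob := lintegral_coboundary_le (measurePreserving_shift ε 1) hwm.log hK (by
    filter_upwards [hw, hg, hlogR] with ω h1 h2 h3
    rw [h1.2]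
    linarith)
  have hgm : Measurable fun ω => Real.log ((1 + w ω) / w ω) :=
    ((measurable_const.add hwm).div hwm).log
  have hsplit : ∫⁻ ω, ENNReal.ofReal (Real.log (w (shift 1 ω)) - Real.log (w ω) + K) ∂noiseLaw ε =
      ENNReal.ofReal (∫ ω, Real.log (R a b 1 ω) ∂noiseLaw ε + K) +
        ∫⁻ ω, ENNReal.ofReal (Real.log ((1 + w ω) / w ω)) ∂noiseLaw ε := by
    have hi := integrable_log_R ha hb hε 1
    have : ∫ ω, Real.log (R a b 1 ω) ∂noiseLaw ε + K =
        ∫ ω, (Real.log (R a b 1 ω) + K) ∂noiseLaw ε := by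
      rw [integral_add hi (integrable_const K)]
      simp
    have hiK : Integrable (fun ω => Real.log (R a b 1 ω) + K) (noiseLaw ε) :=
      hi.add (integrable_const K)
    rw [this, ofReal_integral_eq_lintegral_ofReal hiK (by
      filter_upwards [hlogR] with ω h
      simp only [Pi.zero_apply]
      linarith), ← lintegral_add_right _ hgm.ennreal_ofReal]
    refine lintegral_congr_ae ?_
    filter_upwards [hw, hg, hlogR] with ω h1 h2 h3
    rw [h1.2, ← ENNReal.ofReal_add (by linarith) h2.le]
    ring_nf
  have hpos : 0 < ∫⁻ ω, ENNReal.ofReal (Real.log ((1 + w ω) / w ω)) ∂noiseLaw ε := by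
    rw [pos_iff_ne_zero, ne_eq, lintegral_eq_zero_iff hgm.ennreal_ofReal]
    intro h0
    obtain ⟨ω, h1, h2⟩ := (hg.and h0).exists
    exact (ENNReal.ofReal_pos.2 h1).ne' h2
  rw [hsplit] at hcob
  have hlt : ENNReal.ofReal (∫ ω, Real.log (R a b 1 ω) ∂noiseLaw ε + K) < ENNReal.ofReal K :=
    (ENNReal.lt_add_right ENNReal.ofReal_ne_top hpos.ne').trans_le hcob
  have := (ENNReal.ofReal_lt_ofReal_iff'.1 hlt).1
  linarith [neg_γ_le_integral_log_R ha hb hε]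

/-- If `W` were a finite constant, `W_shift_one` would force `R 1` to be constant. But its inverse
is `a` when `η 0 = 0` and exceeds `a` when `η 0 = 1`, and both events have positive probability. -/
theorem not_ae_W_const (ha : 0 < a) (hb : 0 < b) {ε : I} (hε : ε ∈ Ioo (0 : I) 1)
    (hW : ∀ᵐ ω ∂noiseLaw ε, W a b ω < ∞) :
    ¬∃ c : ℝ≥0∞, ∀ᵐ ω ∂noiseLaw ε, W a b ω = c := by
  rintro ⟨c, hc⟩
  have hc' : ∀ᵐ ω ∂noiseLaw ε, W a b (shift 1 ω) = c :=
    (measurePreserving_shift ε 1).quasiMeasurePreserving.ae hc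
  have hall := (hW.and hc).and (hc'.and (ae_zerosInPast hε.1))
  have hex : ∀ v : Bool, bernoulliMeasure false true ε {v} ≠ 0 → ∃ ω : Noise, ω 0 = v ∧
      W a b ω < ∞ ∧ W a b ω = c ∧ W a b (shift 1 ω) = c ∧ ZerosInPast ω := by
    intro v hv
    have h := noiseLaw_forall_mem_eq ε {0} v
    simp only [Finset.mem_singleton, forall_eq, Finset.card_singleton, pow_one] at h
    have hfreq : ∃ᵐ ω ∂noiseLaw ε, ω 0 = v := by
      rw [frequently_ae_iff, h]
      exact hv
    obtain ⟨ω, h1, h2⟩ := (hfreq.and_eventually hall).exists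
    exact ⟨ω, h1, h2.1.1, h2.1.2, h2.2.1, h2.2.2⟩
  have hε0 : (0 : ℝ) < ε := hε.1
  have hε1 : (ε : ℝ) < 1 := hε.2
  obtain ⟨ω, hω0, hωt, hωc, hωs, hωz⟩ := hex false (by
    rw [bernoulli_false]
    exact (ENNReal.ofReal_pos.2 hε0).ne')
  obtain ⟨ω', hω0', -, hωc', hωs', hωz'⟩ := hex true (by
    rw [bernoulli_true]
    exact (ENNReal.ofReal_pos.2 (by linarith)).ne')
  rw [W_shift_one ha hb, hωc] at hωs
  rw [W_shift_one ha hb, hωc'] at hωs'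
  have hR : R a b 1 ω = R a b 1 ω' := by
    have := hωs.trans hωs'.symm
    rw [ENNReal.mul_left_inj (by simp) (by simp [← hωc, hωt.ne]),
      ENNReal.ofReal_eq_ofReal_iff (R_pos ha hb _ _).le (R_pos ha hb _ _).le] at this
    exact this
  have e1 := inv_R_add_one ha hb hωz 0
  have e2 := inv_R_add_one ha hb hωz' 0
  rw [zero_add] at e1 e2
  rw [hR, e2] at e1
  simp only [η, hω0, hω0', if_true, mul_one] at e1
  have := mul_pos hb (R_pos ha hb 0 ω')
  rw [if_neg Bool.false_ne_true] at e1
  linarith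

end Perpetuity

/-! ### Convergence in distribution of the relative partial sums. -/

section Distribution

variable {a b : ℝ}

theorem partialW_eq_sum (n : ℕ) (ω : Noise) :
    partialW a b n ω = ∑ k ∈ Finset.range n, X a b (n - 1 - k) ω / X a b n ω := by
  rw [partialW, ← Finset.sum_range_reflect, Finset.sum_div]

theorem X_div_le_termW (ha : 0 < a) (hb : 0 < b) {ω : Noise} (hω : ZerosInPast ω) {k n : ℕ}
    (hk : k < n) : X a b (n - 1 - k) (shift (1 - n) ω) / X a b n (shift (1 - n) ω) ≤
      quasiConst a b * termW a b k ω := by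
  have h1 := (X_mul_le ha hb (n - 1 - k) (k + 1) (shift (1 - n) ω)).1
  rw [shift_shift, show n - 1 - k + (k + 1) = n by omega,
    show ((n - 1 - k : ℕ) : ℤ) + (1 - n) = -(k : ℤ) by omega] at h1
  have h2 := (inv_prod_R_bounds ha hb hω (-(k : ℤ)) (k + 1)).2
  rw [← termW_eq] at h2
  have hp := termW_pos ha hb k ω
  have hX := X_pos ha hb n (shift (1 - n) ω)
  have hX1 := X_pos ha hb (n - 1 - k) (shift (1 - n) ω)
  have hC := quasiConst_pos (a := a) hb
  rw [inv_le_iff_one_le_mul₀ hp] at h2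
  rw [div_le_iff₀ hX]
  calc X a b (n - 1 - k) (shift (1 - n) ω)
      ≤ X a b (n - 1 - k) (shift (1 - n) ω) *
        (quasiConst a b * X a b (k + 1) (shift (-k) ω) * termW a b k ω) :=
        le_mul_of_one_le_right hX1.le h2
    _ = quasiConst a b * termW a b k ω *
        (X a b (n - 1 - k) (shift (1 - n) ω) * X a b (k + 1) (shift (-k) ω)) := by ring
    _ ≤ _ := by gcongr

/-- The shift by `1 - n` aligns the last ratio `X (n - 1) / X n` with `R 0`. For large `n` the
window contains a zero before time `-k`, after which the ratios of `X` are exactly stationary. -/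
theorem eventually_X_div_eq_termW (ha : 0 < a) (hb : 0 < b) {ω : Noise} (hω : ZerosInPast ω)
    (k : ℕ) : ∀ᶠ n : ℕ in atTop, k < n ∧
      X a b (n - 1 - k) (shift (1 - n) ω) / X a b n (shift (1 - n) ω) = termW a b k ω := by
  obtain ⟨j, hj, hj0⟩ := hω (-(k : ℤ))
  filter_upwards [eventually_ge_atTop (k + j + 1)] with n hn
  refine ⟨by omega, ?_⟩
  have h := X_eq_X_add_mul_prod ha hb hω (1 - n) (n - 1 - k) (k + 1)
    ⟨n - 1 - k - j, by omega, by rw [← hj0]; congr 1; omega⟩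
  rw [show n - 1 - k + (k + 1) = n by omega,
    show (1 - n : ℤ) + ((n - 1 - k : ℕ) : ℤ) = -(k : ℤ) by omega, ← termW_eq] at h
  rw [h, mul_div_cancel_left₀ _ (X_pos ha hb n _).ne']

theorem tendsto_partialW_shift (ha : 0 < a) (hb : 0 < b) {ω : Noise} (hω : ZerosInPast ω) :
    Tendsto (fun n : ℕ => ENNReal.ofReal (partialW a b n (shift (1 - n) ω))) atTop
      (𝓝 (W a b ω)) := by
  by_cases hW : W a b ω = ∞
  -- If `W` is infinite, a finite partial sum exceeding `M` is eventually part of the relative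
  -- partial sum.
  · rw [hW, ENNReal.tendsto_nhds_top_iff_nat]
    intro M
    have ht := ENNReal.tendsto_nat_tsum fun k => ENNReal.ofReal (termW a b k ω)
    rw [← W_eq_tsum, hW, ENNReal.tendsto_nhds_top_iff_nat] at ht
    obtain ⟨N, hN⟩ := (ht M).exists
    have hev : ∀ᶠ n : ℕ in atTop, ∀ k ∈ Finset.range N, k < n ∧
        X a b (n - 1 - k) (shift (1 - n) ω) / X a b n (shift (1 - n) ω) = termW a b k ω :=
      (eventually_all_finset _).2 fun k _ => eventually_X_div_eq_termW ha hb hω k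
    filter_upwards [hev, eventually_ge_atTop N] with n hn hNn
    refine hN.trans_le ?_
    rw [← ENNReal.ofReal_sum_of_nonneg fun k _ => (termW_pos ha hb k ω).le]
    refine ENNReal.ofReal_le_ofReal ?_
    rw [partialW_eq_sum, Finset.sum_congr rfl fun k hk => (hn k hk).2.symm]
    exact Finset.sum_le_sum_of_subset_of_nonneg (Finset.range_mono hNn) fun k _ _ =>
      (div_pos (X_pos ha hb _ _) (X_pos ha hb _ _)).le
  · have hs : Summable fun k => termW a b k ω := by
      refine (ENNReal.summable_toReal hW).congr fun k => ?_
      exact ENNReal.toReal_ofReal (termW_pos ha hb k ω).le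
    rw [W_eq_tsum, ← ENNReal.ofReal_tsum_of_nonneg (fun k => (termW_pos ha hb k ω).le) hs]
    refine ENNReal.tendsto_ofReal ?_
    have hF : ∀ n : ℕ, partialW a b n (shift (1 - n) ω) = ∑' k : ℕ, if k < n then
        X a b (n - 1 - k) (shift (1 - n) ω) / X a b n (shift (1 - n) ω) else 0 := by
      intro n
      rw [partialW_eq_sum, tsum_eq_sum (s := Finset.range n)]
      · exact Finset.sum_congr rfl fun k hk => by rw [if_pos (Finset.mem_range.1 hk)]
      · intro k hk
        rw [if_neg (by simpa using hk)]
    simp_rw [hF]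
    -- The terms are eventually equal to those of `W`, and dominated by `quasiConst a b` times them.
    refine tendsto_tsum_of_dominated_convergence (hs.mul_left (quasiConst a b)) (fun k => ?_)
      (.of_forall fun n k => ?_)
    · refine tendsto_const_nhds.congr' ?_
      filter_upwards [eventually_X_div_eq_termW ha hb hω k] with n hn
      rw [if_pos hn.1, hn.2]
    · split_ifs with hk
      · rw [Real.norm_eq_abs, abs_of_pos (div_pos (X_pos ha hb _ _) (X_pos ha hb _ _))]
        exact X_div_le_termW ha hb hω hk
      · rw [norm_zero]
        exact (mul_pos (quasiConst_pos hb) (termW_pos ha hb k ω)).le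

theorem tendstoInDistribution_partialW (ha : 0 < a) (hb : 0 < b) {ε : I} (hε : 0 < ε) :
    TendstoInDistribution (fun n ω => ENNReal.ofReal (partialW a b n ω)) atTop
      (W a b) (fun _ : ℕ => noiseLaw ε) (noiseLaw ε) := by
  have hm : ∀ n, Measurable fun ω => ENNReal.ofReal (partialW a b n ω) := fun n =>
    (measurable_partialW n).ennreal_ofReal
  have h := tendstoInDistribution_of_ae_tendsto (μ' := noiseLaw ε) (l := atTop)
    (X := fun (n : ℕ) ω => ENNReal.ofReal (partialW a b n (shift (1 - n) ω))) (Z := W a b)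
    (fun n => ((hm n).comp (measurable_shift _)).aemeasurable) measurable_W.aemeasurable (by
      filter_upwards [ae_zerosInPast hε] with ω hω using tendsto_partialW_shift ha hb hω)
  -- Shifting the noise does not change the law of the `n`-th variable, so the limit in law carries
  -- over from the shifted copies.
  refine ⟨fun n => (hm n).aemeasurable, measurable_W.aemeasurable, h.tendsto.congr fun n => ?_⟩
  refine Subtype.ext ?_
  change (noiseLaw ε).map _ = (noiseLaw ε).map _
  conv_rhs => rw [← (measurePreserving_shift ε (1 - n)).map_eq]
  rw [Measure.map_map (hm n) (measurable_shift _)]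
  rfl

end Distribution

end RandomFib

theorem proposition3p2 (a b : ℝ) (ha : a ∈ Ioo (0 : ℝ) 1) (hb : 1 - a < b)
    (ε : I) (hε : ε ∈ Ioo (0 : I) 1) :
    -- the objects in the equivalence are well defined
    (RandomFib.εstar a b ∈ Ioo (0 : I) 1 ∧ RandomFib.γ a b (RandomFib.εstar a b) = 0) ∧
    Tendsto (fun n : ℕ => (n : ℝ)⁻¹ * ∫ ω, Real.log (RandomFib.X a b n ω) ∂(RandomFib.noiseLaw ε))
      atTop (𝓝 (RandomFib.γ a b ε)) ∧
    (∀ᵐ ω ∂(RandomFib.noiseLaw ε),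
      Tendsto (fun n : ℕ => (n : ℝ)⁻¹ * Real.log (RandomFib.X a b n ω))
        atTop (𝓝 (RandomFib.γ a b ε))) ∧
    (∀ t : ℝ, 0 ≤ t →
      Tendsto (fun n : ℕ => (n : ℝ)⁻¹ * Real.log
          (∫ ω, ∏ k ∈ Finset.Icc 1 n, RandomFib.R a b (k : ℤ) ω ^ t ∂(RandomFib.noiseLaw ε)))
        atTop (𝓝 (RandomFib.Λ a b ε t)) ∧
      Tendsto (fun n : ℕ => (n : ℝ)⁻¹ * Real.log
          (∫ ω, RandomFib.X a b n ω ^ (-t) ∂(RandomFib.noiseLaw ε)))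
        atTop (𝓝 (RandomFib.Λ a b ε t))) ∧
    DifferentiableWithinAt ℝ (RandomFib.Λ a b ε) (Ici 0) 0 ∧
    TendstoInDistribution (fun n ω => ENNReal.ofReal (RandomFib.partialW a b n ω)) atTop
      (RandomFib.W a b) (fun _ : ℕ => RandomFib.noiseLaw ε) (RandomFib.noiseLaw ε) ∧
    -- the equivalence
    List.TFAE [
      0 < RandomFib.γ a b ε,
      ε < RandomFib.εstar a b,
      derivWithin (RandomFib.Λ a b ε) (Ici 0) 0 < 0,
      ∃! s : ℝ, 0 < s ∧ RandomFib.Λ a b ε s = 0,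
      (∀ᵐ ω ∂(RandomFib.noiseLaw ε), RandomFib.W a b ω < ∞) ∧
        ¬ ∃ c : ℝ≥0∞, ∀ᵐ ω ∂(RandomFib.noiseLaw ε), RandomFib.W a b ω = c] := by
  have hb0 : 0 < b := by linarith [ha.2]
  have hd := RandomFib.hasDerivWithinAt_Λ ha.1 hb0 hε.1
  refine ⟨(RandomFib.εstar_spec ha hb).1, (RandomFib.γ_spec ha.1 hb0 ε).1,
    RandomFib.ae_tendsto_log_X ha.1 hb0 ε, fun t ht => ⟨(RandomFib.Λ_spec ha.1 hb0 hε.1 ht).1, ?_⟩,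
    hd.differentiableWithinAt, RandomFib.tendstoInDistribution_partialW ha.1 hb0 hε.1, ?_⟩
  · simp_rw [RandomFib.log_integral_X_rpow ha.1 hb0]
    exact (RandomFib.Λ_spec ha.1 hb0 hε.1 ht).2.1
  tfae_have 1 ↔ 2 := (RandomFib.εstar_spec ha hb).2 ε
  tfae_have 1 ↔ 3 := by
    rw [hd.derivWithin (uniqueDiffOn_Ici 0 0 self_mem_Ici), neg_lt_zero]
  tfae_have 1 ↔ 4 := RandomFib.existsUnique_Λ_zero_iff ha hb0 hε.1
  tfae_have 1 → 5 := fun h =>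
    have hW := RandomFib.ae_W_lt_top ha.1 hb0 hε.1 h
    ⟨hW, RandomFib.not_ae_W_const ha.1 hb0 hε hW⟩
  tfae_have 5 → 1 := fun h => RandomFib.γ_pos_of_ae_W_lt_top ha.1 hb0 hε.1 h.1
  tfae_finish
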